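/- **Setting.** Let $G=(V,E)$ be a triangular lattice graph on $n=|V|\ge 1$ vertices: a finite induced subgraph of the infinite triangular lattice in which every vertex lies in a triangle. Let $\mathbf A$ be its adjacency matrix and $$|G\rangle=2^{-n/2}\sum_{x\in\{0,1\}^V}(-1)^{\frac12 x\cdot \mathbf A x}|x\rangle$$ its graph state (triangular cluster state). Let $T$ be a set of triangles of $G$ covering $V$, put $N_G=3|V|+|T|$, fix for each $v\in V$ a neighbour $u(v)$, and for each $v$ an angle $0\le\theta_v\le\pi/2$. *Provers.* There is one prover for each $v\in V$. It receives at most one question from $\{X,Z,R(\theta_v),R(-\theta_v)\}$ and replies $\pm1$. A set of provers is a pure joint state (unit vector) in a complex Hilbert space of arbitrary dimension together with, for each prover and each question, a self-adjoint observable with square $1$, such that observables of different provers commute (for instance because they act on different tensor factors). The honest provers each hold one qubit of $|G\rangle$ and measure $X$, $Z$ and $R(\pm\theta_v)=\cos\theta_v\,X\pm\sin\theta_v\,Z$. *Adaptive measurement.* An adaptive measurement asks provers one after another, each at most once, the next question (and which prover gets it) depending on the previous replies, and finally accepts or rejects depending on the replies. *Test for honesty.* With probability $|V|/N_G$ (VERTEX):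 pick $v\in V$ uniformly, ask $X$ of $v$ and $Z$ of its neighbours, and accept iff the product of the replies is $1$. With probability $|T|/N_G$ (TRIANGLE): pick $\tau\in T$ uniformly, ask $X$ of the vertices of $\tau$ and $Z$ of the other vertices with an odd number of neighbours in $\tau$, and accept iff the product is $-1$. With probability $2|V|/N_G$ (RTHETA): pick $t\in\{1,-1\}$ and $v\in V$ uniformly and let $u=u(v)$; with probability $\frac{\cos\theta_v}{\cos\theta_v+|\sin\theta_v|}$ ask $R(t\theta_v)$ of $v$ and $Z$ of its neighbours, and accept iff the product is $1$; otherwise ask $R(t\theta_v)$ of $v$, $X$ of $u$, and $Z$ of the neighbours of $u$ other than $v$, and accept iff $t$ times the product is $1$. Provers that are not asked are ignored. *Protocol.* With probability $q$ (CALCULATE) perform a given adaptive measurement and accept iff it accepts; with probability $1-q$ (TEST) perform the test for honesty and accept iff it accepts. **Lemma.** Let $L$ be a language and $x$ an input. Suppose that the given adaptive measurement, made on $|G\rangle$ with the ideal observables, decides whether $x\in L$ with error at most $\frac13$: there are numbers $c_{calc}\ge\frac23$ and $s_{calc}\le\frac13$ such that it accepts with probability at least $c_{calc}$ if $x\in L$,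 and at most $s_{calc}$ if $x\notin L$. Let $0<\delta<\frac16$ and set $$c_{test}=\frac{2|V|+|T|+\sum_{v}\frac1{\cos\theta_v+|\sin\theta_v|}}{N_G},\qquad s_{test}=c_{test}-\frac{\delta^8}{10^{17.7}n^{11}},\qquad q=\frac{c_{test}-s_{test}}{1+c_{test}-s_{calc}-s_{test}-\delta},$$ $$c_{ip}=q\,c_{calc}+(1-q)\,c_{test},\qquad s_{ip}=\max\{\,q(s_{calc}+\delta)+(1-q)c_{test},\; q+(1-q)s_{test}\,\}.$$ Then $0\le q\le 1$, and - if $x\in L$, then with the honest provers the protocol accepts with probability at least $c_{ip}$; - if $x\notin L$, then with any set of provers the protocol accepts with probability at most $s_{ip}$; - $\displaystyle c_{ip}-s_{ip}\ge\frac{\delta^8}{10^{18.8}\,n^{11}}.$ -/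

import Mathlib

namespace MBQC

/-! ## Triangular lattice graphs and graph states -/

/-- The infinite triangular lattice: the points of `ℤ × ℤ`, each adjacent to the six points at
`±(1, 0)`, `±(0, 1)`, `±(1, -1)` from it. -/
def triangularLattice : SimpleGraph (ℤ × ℤ) :=
  SimpleGraph.fromRel fun p q =>
    q - p = (1, 0) ∨ q - p = (0, 1) ∨ q - p = (1, -1)

/-- A (finite) triangular lattice graph: a nonempty piece, i.e. induced subgraph, of the infinite
triangular lattice in which every vertex lies in a triangle. -/
def IsTriangularLattice {V : Type*} (G : SimpleGraph V) : Prop :=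
  Nonempty V ∧ Nonempty (G ↪g triangularLattice) ∧
    ∀ v, ∃ τ : Finset V, G.IsNClique 3 τ ∧ v ∈ τ

/-- The graph state `2^(-n/2) ∑_x (-1)^(e(x)) |x⟩`, where `e(x)` is the number of edges of `G` with
both ends in `{v | x v = 1}`. -/
noncomputable def graphState {V : Type*} [Fintype V] [DecidableEq V] (G : SimpleGraph V)
    [DecidableRel G.Adj] : EuclideanSpace ℂ (V → Fin 2) :=
  WithLp.toLp 2 fun x =>
    (1 / (Real.sqrt (2 ^ Fintype.card V) : ℂ)) *
      (-1) ^ (G.edgeFinset.filter fun e => ∀ v ∈ e, x v = 1).card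

theorem norm_graphState {V : Type*} [Fintype V] [DecidableEq V] (G : SimpleGraph V)
    [DecidableRel G.Adj] : ‖graphState G‖ = 1 := by
  have h2 : (0 : ℝ) < 2 ^ Fintype.card V := by positivity
  rw [EuclideanSpace.norm_eq, Real.sqrt_eq_one]
  have : ∀ x : V → Fin 2, ‖(graphState G) x‖ ^ 2 = 1 / 2 ^ Fintype.card V := by
    intro x
    simp only [graphState, norm_mul, norm_div, norm_one, norm_pow, norm_neg, one_pow, mul_one,
      Complex.norm_real, Real.norm_eq_abs, abs_of_nonneg (Real.sqrt_nonneg _), div_pow,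
      Real.sq_sqrt h2.le]
  simp only [this, Finset.sum_const, Finset.card_univ, Fintype.card_pi, Fintype.card_fin,
    Finset.prod_const, nsmul_eq_mul]
  push_cast
  field_simp

/-! ## Provers -/

/-- The four questions that a prover can be asked: `X`, `Z`, and `R t` with `t = ±1`, which stands
for the measurement `R(t θ)` at the angle `t θ`, where `θ` is the angle of that prover. -/
inductive Query
  | X
  | Z
  | R (t : ℤˣ)

/-- A strategy of non-communicating quantum provers, one for each `v : V`: a pure joint state in a
Hilbert space of any dimension, and for each prover and each question a `±1`-valued observable.
The provers act on separate systems; all that is asked of the space is that observables of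
different provers commute, so operators on the different factors of a tensor product of Hilbert
spaces, of finite or infinite dimension, are covered (see `Provers.tensor`). -/
structure Provers (V : Type*) (H : Type*) [NormedAddCommGroup H] [InnerProductSpace ℂ H]
    [CompleteSpace H] where
  state : H
  norm_state : ‖state‖ = 1
  obs : V → Query → H →L[ℂ] H
  isSelfAdjoint_obs : ∀ v b, IsSelfAdjoint (obs v b)
  obs_mul_self : ∀ v b, obs v b * obs v b = 1
  commute_obs : ∀ v w, v ≠ w → ∀ b c, Commute (obs v b) (obs w c)

/-- The operator `1 ⊗ ⋯ ⊗ M ⊗ ⋯ ⊗ 1` on the tensor product of the spaces `ℂ^(D w)`, with `M` in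
place `v`. -/
noncomputable def localOp {V : Type*} [Fintype V] [DecidableEq V] {D : V → Type*}
    [∀ v, Fintype (D v)] (v : V) (M : Matrix (D v) (D v) ℂ) :
    EuclideanSpace ℂ (∀ v, D v) →L[ℂ] EuclideanSpace ℂ (∀ v, D v) :=
  LinearMap.toContinuousLinearMap
    { toFun := fun φ => WithLp.toLp 2 fun x => ∑ a, M (x v) a * φ (Function.update x v a)
      map_add' := by
        intro φ χ
        ext x
        simp [mul_add, Finset.sum_add_distrib]
      map_smul' := by
        intro c φ
        ext x
        simp [Finset.mul_sum, mul_left_comm] }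

section localOp

variable {V : Type*} [Fintype V] [DecidableEq V] {D : V → Type*} [∀ v, Fintype (D v)]

theorem localOp_apply (v : V) (M : Matrix (D v) (D v) ℂ) (φ : EuclideanSpace ℂ (∀ v, D v))
    (x : ∀ v, D v) :
    localOp v M φ x = ∑ a, M (x v) a * φ (Function.update x v a) := rfl

theorem localOp_mul (v : V) (M N : Matrix (D v) (D v) ℂ) :
    localOp v M * localOp v N = localOp v (M * N) := by
  ext φ x
  simp only [mul_apply_eq_comp, localOp_apply, Function.update_self,
    Function.update_idem, Matrix.mul_apply, Finset.sum_mul, Finset.mul_sum]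
  rw [Finset.sum_comm]
  simp only [mul_assoc]

theorem localOp_one [∀ v, DecidableEq (D v)] (v : V) :
    localOp v (1 : Matrix (D v) (D v) ℂ) = 1 := by
  ext φ x
  simp [localOp_apply, Matrix.one_apply]

theorem localOp_commute {v w : V} (h : v ≠ w) (M : Matrix (D v) (D v) ℂ)
    (N : Matrix (D w) (D w) ℂ) : Commute (localOp v M) (localOp w N) := by
  ext φ x
  simp only [mul_apply_eq_comp, localOp_apply, Function.update_of_ne h,
    Function.update_of_ne h.symm, Finset.mul_sum]
  rw [Finset.sum_comm]
  refine Finset.sum_congr rfl fun a _ => Finset.sum_congr rfl fun b _ => ?_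
  rw [Function.update_comm h]
  ring

theorem localOp_isSelfAdjoint (v : V) {M : Matrix (D v) (D v) ℂ} (hM : M.IsHermitian) :
    IsSelfAdjoint (localOp v M) := by
  rw [ContinuousLinearMap.isSelfAdjoint_iff_isSymmetric]
  intro φ χ
  simp only [ContinuousLinearMap.coe_coe, PiLp.inner_apply, RCLike.inner_apply, localOp_apply,
    map_sum, map_mul, Finset.mul_sum]
  rw [← Fintype.sum_prod_type' (f := fun (x : ∀ v, D v) (a : D v) =>
      χ x * ((starRingEnd ℂ) (M (x v) a) * (starRingEnd ℂ) (φ (Function.update x v a))))]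
  simp only [Finset.sum_mul]
  rw [← Fintype.sum_prod_type' (f := fun (x : ∀ v, D v) (a : D v) =>
      M (x v) a * χ (Function.update x v a) * (starRingEnd ℂ) (φ x))]
  refine Fintype.sum_equiv
    { toFun := fun p => (Function.update p.1 v p.2, p.1 v)
      invFun := fun p => (Function.update p.1 v p.2, p.1 v)
      left_inv := fun p => by simp
      right_inv := fun p => by simp } _ _ ?_
  rintro ⟨x, a⟩
  have := hM.apply a (x v)
  simp only [Equiv.coe_fn_mk, Function.update_self, Function.update_idem, Function.update_eq_self]
  rw [← this]
  simp only [RCLike.star_def]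
  ring

end localOp

/-- Provers that hold a joint state in the tensor product of the spaces `ℂ^(D v)`, the prover `v`
measuring the factor `v` with the observable `M v b` when asked `b`. -/
noncomputable def Provers.tensor {V : Type*} [Fintype V] [DecidableEq V] {D : V → Type*}
    [∀ v, Fintype (D v)] [∀ v, DecidableEq (D v)] (ψ : EuclideanSpace ℂ (∀ v, D v))
    (hψ : ‖ψ‖ = 1) (M : ∀ v, Query → Matrix (D v) (D v) ℂ) (hM : ∀ v b, (M v b).IsHermitian)
    (hM2 : ∀ v b, M v b * M v b = 1) : Provers V (EuclideanSpace ℂ (∀ v, D v)) where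
  state := ψ
  norm_state := hψ
  obs := fun v b => localOp v (M v b)
  isSelfAdjoint_obs := fun v b => localOp_isSelfAdjoint v (hM v b)
  obs_mul_self := fun v b => by rw [localOp_mul, hM2, localOp_one]
  commute_obs := fun _ _ h _ _ => localOp_commute h _ _

/-- The Pauli matrix `X`. -/
def pauliX : Matrix (Fin 2) (Fin 2) ℂ := !![0, 1; 1, 0]

/-- The Pauli matrix `Z`. -/
def pauliZ : Matrix (Fin 2) (Fin 2) ℂ := !![1, 0; 0, -1]

/-- `R(θ) = cos θ X + sin θ Z`. -/
noncomputable def rotR (θ : ℝ) : Matrix (Fin 2) (Fin 2) ℂ :=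
  (Real.cos θ : ℂ) • pauliX + (Real.sin θ : ℂ) • pauliZ

/-- The ideal qubit observable for each question, at the angle `θ`. -/
noncomputable def idealObs (θ : ℝ) : Query → Matrix (Fin 2) (Fin 2) ℂ
  | .X => pauliX
  | .Z => pauliZ
  | .R t => rotR (((t : ℤ) : ℝ) * θ)

theorem idealObs_isHermitian (θ : ℝ) (b : Query) : (idealObs θ b).IsHermitian := by
  apply Matrix.IsHermitian.ext
  cases b <;> intro i j <;> fin_cases i <;> fin_cases j <;>
    simp [idealObs, pauliX, pauliZ, rotR,
      -Complex.ofReal_cos, -Complex.ofReal_sin]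

theorem idealObs_mul_self (θ : ℝ) (b : Query) : idealObs θ b * idealObs θ b = 1 := by
  have h : ∀ η : ℝ, ((Real.cos η : ℂ)) * (Real.cos η : ℂ) +
      (Real.sin η : ℂ) * (Real.sin η : ℂ) = 1 := by
    intro η
    have := Real.cos_sq_add_sin_sq η
    rw [sq, sq] at this
    exact_mod_cast this
  rcases b with _ | _ | t
  · ext i j
    fin_cases i <;> fin_cases j <;> simp [idealObs, pauliX, Matrix.mul_apply]
  · ext i j
    fin_cases i <;> fin_cases j <;> simp [idealObs, pauliZ, Matrix.mul_apply]
  · have h' := h (((t : ℤ) : ℝ) * θ)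
    simp only [idealObs, rotR]
    generalize (Real.cos (((t : ℤ) : ℝ) * θ) : ℂ) = c at *
    generalize (Real.sin (((t : ℤ) : ℝ) * θ) : ℂ) = s at *
    ext i j
    fin_cases i <;> fin_cases j <;>
      simp [pauliX, pauliZ, Matrix.mul_apply] <;>
      first | linear_combination h' | ring

/-- The honest provers: each holds one qubit of the graph state of `G`, and measures it with the
ideal observables `X`, `Z`, `R(± θ v)`. -/
noncomputable def honest {V : Type*} [Fintype V] [DecidableEq V] (G : SimpleGraph V)
    [DecidableRel G.Adj] (θ : V → ℝ) : Provers V (EuclideanSpace ℂ (V → Fin 2)) :=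
  Provers.tensor (D := fun _ => Fin 2) (graphState G) (norm_graphState G)
    (fun v => idealObs (θ v)) (fun v => idealObs_isHermitian (θ v))
    (fun v => idealObs_mul_self (θ v))

/-! ## Adaptive measurements -/

/-- An adaptive measurement, i.e. a deterministic interaction of a classical verifier with the
provers: either halt and accept or reject, or put a question to one of the provers and go on in a
way that depends on the reply `±1`. -/
inductive AdaptiveMeasurement (V : Type*)
  | halt (accept : Bool)
  | ask (v : V) (b : Query) (next : ℤˣ → AdaptiveMeasurement V)

/-- No prover is asked more than once, and those in `S` are not asked at all. -/
def AdaptiveMeasurement.AsksOnce {V : Type*} : AdaptiveMeasurement V → Set V → Prop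
  | .halt _, _ => True
  | .ask v _ next, S => v ∉ S ∧ ∀ r, (next r).AsksOnce (insert v S)

section acceptance

variable {V : Type*} {H : Type*} [NormedAddCommGroup H] [InnerProductSpace ℂ H] [CompleteSpace H]

/-- The projection `(1 + r M) / 2` onto the eigenspace, for the eigenvalue `r = ±1`, of the
observable `M` that prover `v` measures when asked `b`. -/
noncomputable def Provers.proj (P : Provers V H) (v : V) (b : Query) (r : ℤˣ) : H →L[ℂ] H :=
  (1 / 2 : ℂ) • (1 + ((r : ℤ) : ℂ) • P.obs v b)

/-- The probability of acceptance by the Born rule, when the provers start in `φ`. The vectors `φ`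
are not normalized along the way: the squared norm is the probability of the replies so far. -/
noncomputable def Provers.acceptFrom (P : Provers V H) : AdaptiveMeasurement V → H → ℝ
  | .halt accept, φ => if accept then ‖φ‖ ^ 2 else 0
  | .ask v b next, φ => ∑ r : ℤˣ, P.acceptFrom (next r) (P.proj v b r φ)

/-- The probability that the adaptive measurement `A`, made with the provers `P`, accepts. -/
noncomputable def Provers.accept (P : Provers V H) (A : AdaptiveMeasurement V) : ℝ :=
  P.acceptFrom A P.state

end acceptance

/-! ## The test for honesty -/

/-- Ask the provers `v` in the list the question `q v`, ignoring those with `q v = none`, and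
accept if `acc` times the product of the replies is `target`. -/
def askList {V : Type*} (q : V → Option Query) (target : ℤˣ) :
    List V → ℤˣ → AdaptiveMeasurement V
  | [], acc => .halt (decide (acc = target))
  | v :: l, acc =>
    match q v with
    | none => askList q target l acc
    | some b => .ask v b fun r => askList q target l (acc * r)

/-- Ask every prover `v` the question `q v`, ignoring those with `q v = none`, and accept if the
product of the replies is `target`. Observables of different provers commute, so the order in which
they are listed is immaterial. -/
noncomputable def askProduct {V : Type*} [Fintype V] (q : V → Option Query) (target : ℤˣ) :
    AdaptiveMeasurement V :=
  askList q target Finset.univ.toList 1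

section test

variable {V : Type*} [Fintype V] [DecidableEq V] (G : SimpleGraph V) [DecidableRel G.Adj]

/-- The bases of the stabilizer `X_v Z^(A 1_v)`. -/
def vertexQuery (v : V) : V → Option Query := fun w =>
  if w = v then some .X else if G.Adj v w then some .Z else none

/-- The bases of `X^τ Z^(A τ)` for a triangle `τ`, with `A τ` taken modulo two. (No vertex of `τ`
is in `A τ`, since it has exactly two neighbours in `τ`.) -/
def triangleQuery (τ : Finset V) : V → Option Query := fun w =>
  if w ∈ τ then some .X
  else if Odd (τ.filter fun v => G.Adj v w).card then some .Z else none

/-- The bases of `R_v(t θ_v) Z^(A 1_v)`. -/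
def rthetaXQuery (v : V) (t : ℤˣ) : V → Option Query := fun w =>
  if w = v then some (.R t) else if G.Adj v w then some .Z else none

/-- The bases of `R_v(t θ_v) X_u Z^(A 1_u ⊕ 1_v)`, for neighbours `u` and `v`. -/
def rthetaZQuery (v u : V) (t : ℤˣ) : V → Option Query := fun w =>
  if w = v then some (.R t)
  else if w = u then some .X
  else if G.Adj u w then some .Z else none

/-- `N_G = 3 |V| + |T|`. -/
def numSubtests (V : Type*) [Fintype V] (T : Finset (Finset V)) : ℕ :=
  3 * Fintype.card V + T.card

variable {H : Type*} [NormedAddCommGroup H] [InnerProductSpace ℂ H] [CompleteSpace H]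

/-- The probability that the provers `P` pass the `RTHETA` subtest for the vertex `v` and the sign
`t`, where `u` is the chosen neighbour of `v`, and `θ` the angle of `v`. -/
noncomputable def rthetaAccept (v u : V) (θ : ℝ) (t : ℤˣ) (P : Provers V H) : ℝ :=
  Real.cos θ / (Real.cos θ + |Real.sin θ|) * P.accept (askProduct (rthetaXQuery G v t) 1) +
  |Real.sin θ| / (Real.cos θ + |Real.sin θ|) * P.accept (askProduct (rthetaZQuery G v u t) t)

/-- The probability that the provers `P` pass the test for honesty, for the covering set of
triangles `T`, the choice `u v` of a neighbour of each vertex `v`, and the angles `θ`. The test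
picks `VERTEX`, `TRIANGLE` or `RTHETA` with probabilities `|V| / N_G`, `|T| / N_G` and
`2 |V| / N_G`, and then one of the corresponding subtests uniformly. -/
noncomputable def testAccept (T : Finset (Finset V)) (u : V → V) (θ : V → ℝ) (P : Provers V H) :
    ℝ :=
  (Fintype.card V : ℝ) / numSubtests V T *
      (1 / (Fintype.card V : ℝ) * ∑ v, P.accept (askProduct (vertexQuery G v) 1)) +
  (T.card : ℝ) / numSubtests V T *
      (1 / (T.card : ℝ) * ∑ τ ∈ T, P.accept (askProduct (triangleQuery G τ) (-1))) +
  2 * (Fintype.card V : ℝ) / numSubtests V T *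
      (1 / 2 * ∑ t : ℤˣ, 1 / (Fintype.card V : ℝ) * ∑ v, rthetaAccept G v (u v) (θ v) t P)

/-! ## The interactive proof -/

/-- The probability that the verifier accepts in the interactive proof with the provers `P`: with
probability `q` it makes the adaptive measurement `A` (`CALCULATE`), and with probability `1 - q`
the test for honesty (`TEST`). -/
noncomputable def ipAccept (T : Finset (Finset V)) (u : V → V) (θ : V → ℝ)
    (A : AdaptiveMeasurement V) (q : ℝ) (P : Provers V H) : ℝ :=
  q * P.accept A + (1 - q) * testAccept G T u θ P

end test

/-- `c_test = (2 |V| + |T| + ∑_v 1 / (cos θ_v + |sin θ_v|)) / N_G`. -/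
noncomputable def cTest {V : Type*} [Fintype V] (T : Finset (Finset V)) (θ : V → ℝ) : ℝ :=
  (2 * Fintype.card V + T.card + ∑ v, 1 / (Real.cos (θ v) + |Real.sin (θ v)|)) /
    numSubtests V T

/-- `s_test = c_test - δ^8 / (10^17.7 n^11)`. -/
noncomputable def sTest {V : Type*} [Fintype V] (T : Finset (Finset V)) (θ : V → ℝ) (δ : ℝ) : ℝ :=
  cTest T θ - δ ^ 8 / ((10 : ℝ) ^ (17.7 : ℝ) * (Fintype.card V : ℝ) ^ 11)

/-- The probability `q = (c_test - s_test) / (1 + c_test - s_calc - s_test - δ)` of choosing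
`CALCULATE`. -/
noncomputable def qCalculate (cTest sTest sCalc δ : ℝ) : ℝ :=
  (cTest - sTest) / (1 + cTest - sCalc - sTest - δ)

/-- `c_ip = q c_calc + (1 - q) c_test`. -/
noncomputable def cIP (q cTest cCalc : ℝ) : ℝ :=
  q * cCalc + (1 - q) * cTest

/-- `s_ip`, the larger of `q (s_calc + δ) + (1 - q) c_test` and `q + (1 - q) s_test`. -/
noncomputable def sIP (q cTest sTest sCalc δ : ℝ) : ℝ :=
  max (q * (sCalc + δ) + (1 - q) * cTest) (q + (1 - q) * sTest)

end MBQC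

/-!
The proof rests on the self-test of the graph state by the test for honesty.

*The test.* A product of replies is tested by measuring a projection (`acceptFrom_askList`), so each
subtest fails with probability a quarter of a squared distance. For the `RTHETA` subtest of a vertex
the two signs of the angle have to be taken together: the cross terms of `cos θ` and `sin θ` cancel
in the sum, whatever the operators are. Hence `N_G (c_test - Pr[pass])` is a sum of squares
(`cTest_sub_testAccept`), which bounds the passing probability by `c_test` for all provers, gives
equality for the honest ones, and shows that every single relation tested holds up to a small error
for provers that pass with probability more than `s_test`.

*Anticommutation.* In the product of the stabilizers of the vertices of a triangle `a b c` with the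
operator of `TRIANGLE` everything cancels except `Z X Z X` at `b` (`stabilizer_mul_triangle`), so
this operator is close to `-1` on the state, i.e. `X_b` and `Z_b` nearly anticommute there. As
`RTHETA` expresses `R(± θ)` through operators that `VERTEX` identifies with `X` and `Z`, also
`R(± θ)` is close to `cos θ X ± sin θ Z` on the state.

*Swap isometry.* The isometry `swap` from the provers' space `H` into `(ℂ²)^V ⊗ H` intertwines `Z`
with the Pauli matrix exactly, and `X` up to an error whose squared norm is half that of the
anticommutator (`norm_swap_obs_X_sub`). It therefore takes the state to a vector nearly fixed by the
stabilizers of the graph state, which is close to `|G⟩ ⊗ χ` for some `χ`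
(`exists_graphState_near`).

*Adaptive measurements.* A measurement is compared with the ideal one by replacing the observables
one question at a time (`acceptFrom_le_ideal`). The errors are quadratic forms in the state which
commute with all questions put to other provers, so that summing over the branches of the
measurement does not enlarge them, and the total error is polynomial in `n`. With the test passed up
to `s_test` it is at most `δ` (`accept_le_honest_add`). The geometry of the lattice enters only by
way of the triangle through each vertex; the number of triangles is bounded by `n ^ 3`.
-/

namespace MBQC

open Finset

/-! ### Reflections, projections and acceptance probabilities -/

theorem sum_intUnits {M : Type*} [AddCommMonoid M] (f : ℤˣ → M) : ∑ r, f r = f 1 + f (-1) := by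
  rw [UnitsInt.univ, Finset.sum_pair (by decide)]

section basics

variable {V : Type*} {H : Type*} [NormedAddCommGroup H] [InnerProductSpace ℂ H] [CompleteSpace H]
  (P : Provers V H)

theorem Provers.obs_obs_apply (v : V) (b : Query) (φ : H) : P.obs v b (P.obs v b φ) = φ := by
  simpa using congrArg (fun M : H →L[ℂ] H => M φ) (P.obs_mul_self v b)

theorem Provers.inner_obs_left (v : V) (b : Query) (φ χ : H) :
    inner ℂ (P.obs v b φ) χ = inner ℂ φ (P.obs v b χ) :=
  (ContinuousLinearMap.isSelfAdjoint_iff_isSymmetric.1 (P.isSelfAdjoint_obs v b)) φ χ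

theorem Provers.norm_obs_apply (v : V) (b : Query) (φ : H) : ‖P.obs v b φ‖ = ‖φ‖ := by
  have h : ‖P.obs v b φ‖ ^ 2 = ‖φ‖ ^ 2 := by
    rw [← inner_self_eq_norm_sq (𝕜 := ℂ), ← inner_self_eq_norm_sq (𝕜 := ℂ), P.inner_obs_left,
      P.obs_obs_apply]
  exact (sq_eq_sq₀ (norm_nonneg _) (norm_nonneg _)).1 h

theorem Provers.proj_apply (v : V) (b : Query) (r : ℤˣ) (φ : H) :
    P.proj v b r φ = (1 / 2 : ℂ) • (φ + ((r : ℤ) : ℂ) • P.obs v b φ) := by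
  simp [Provers.proj]

theorem Provers.commute_proj {v : V} {b : Query} {M : H →L[ℂ] H} (h : Commute (P.obs v b) M)
    (r : ℤˣ) : Commute (P.proj v b r) M :=
  ((Commute.one_left M).add_left (h.smul_left _)).smul_left _

/-- The two replies to a question have total probability one. -/
theorem Provers.sum_norm_proj_sq (v : V) (b : Query) (φ : H) :
    ∑ r, ‖P.proj v b r φ‖ ^ 2 = ‖φ‖ ^ 2 := by
  have h := parallelogram_law_with_norm ℂ φ (P.obs v b φ)
  rw [P.norm_obs_apply] at h
  rw [sum_intUnits, P.proj_apply, P.proj_apply, norm_smul, norm_smul]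
  simp only [Units.val_one, Int.cast_one, one_smul, Units.val_neg, Int.cast_neg, neg_smul,
    ← sub_eq_add_neg]
  norm_num
  linarith

theorem Provers.acceptFrom_ask (v : V) (b : Query) (next : ℤˣ → AdaptiveMeasurement V) (φ : H) :
    P.acceptFrom (.ask v b next) φ = ∑ r, P.acceptFrom (next r) (P.proj v b r φ) := rfl

theorem Provers.acceptFrom_nonneg (A : AdaptiveMeasurement V) (φ : H) :
    0 ≤ P.acceptFrom A φ := by
  induction A generalizing φ with
  | halt a => unfold Provers.acceptFrom; split_ifs <;> positivity
  | ask v b next ih => exact sum_nonneg fun r _ => ih r _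

theorem Provers.acceptFrom_le (A : AdaptiveMeasurement V) (φ : H) :
    P.acceptFrom A φ ≤ ‖φ‖ ^ 2 := by
  induction A generalizing φ with
  | halt a => unfold Provers.acceptFrom; split_ifs <;> simp
  | ask v b next ih =>
    rw [← P.sum_norm_proj_sq v b]
    exact sum_le_sum fun r _ => ih r _

theorem Provers.accept_le_one (A : AdaptiveMeasurement V) : P.accept A ≤ 1 := by
  simpa [Provers.accept, P.norm_state] using P.acceptFrom_le A P.state

/-- Young's inequality for the square of a norm. -/
theorem norm_sq_le_weighted {E : Type*} [SeminormedAddCommGroup E] (a b : E) {κ : ℝ}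
    (hκ : 0 < κ) : ‖a‖ ^ 2 ≤ (1 + κ) * ‖b‖ ^ 2 + (1 + 1 / κ) * ‖a - b‖ ^ 2 := by
  have h1 : ‖a‖ ≤ ‖b‖ + ‖a - b‖ := by
    simpa using norm_add_le b (a - b)
  have h2 : ‖a‖ ^ 2 ≤ (‖b‖ + ‖a - b‖) ^ 2 := by gcongr
  have h3 : 0 ≤ 1 / κ * (κ * ‖b‖ - ‖a - b‖) ^ 2 := by positivity
  have h4 : 1 / κ * (κ * ‖b‖ - ‖a - b‖) ^ 2 =
      κ * ‖b‖ ^ 2 - 2 * ‖b‖ * ‖a - b‖ + 1 / κ * ‖a - b‖ ^ 2 := by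
    field_simp
    ring
  nlinarith

/-- Acceptance probabilities depend on the starting vector continuously, in a form that adds up
over the branches of a measurement. -/
theorem Provers.acceptFrom_le_add (A : AdaptiveMeasurement V) (φ χ : H) {κ : ℝ} (hκ : 0 < κ) :
    P.acceptFrom A φ ≤
      P.acceptFrom A χ + κ * ‖χ‖ ^ 2 + (1 + 1 / κ) * ‖φ - χ‖ ^ 2 := by
  induction A generalizing φ χ with
  | halt a =>
    have := norm_sq_le_weighted φ χ hκ
    have h2 : 0 ≤ κ * ‖χ‖ ^ 2 + (1 + 1 / κ) * ‖φ - χ‖ ^ 2 := by positivity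
    cases a <;> simp only [Provers.acceptFrom] <;> simp <;> simp at this h2 <;> linarith
  | ask v b next ih =>
    have := sum_le_sum fun r (_ : r ∈ univ) => ih r (P.proj v b r φ) (P.proj v b r χ)
    simp only [sum_add_distrib, ← mul_sum, ← map_sub, P.sum_norm_proj_sq] at this
    exact this

/-- The product of the observables named by `q`, the provers being taken in the order of `l`. -/
noncomputable def Provers.listOp (q : V → Option Query) (l : List V) : H →L[ℂ] H :=
  (l.map fun v => (q v).elim 1 (P.obs v)).prod

theorem Provers.commute_listOp {q : V → Option Query} {l : List V} {v : V} (hv : v ∉ l)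
    (b : Query) : Commute (P.obs v b) (P.listOp q l) := by
  refine Commute.list_prod_right _ _ fun M hM => ?_
  obtain ⟨w, hw, rfl⟩ := List.mem_map.1 hM
  have hvw : v ≠ w := fun h => hv (h ▸ hw)
  cases q w with
  | none => exact Commute.one_right _
  | some c => exact P.commute_obs v w hvw b c

/-- Accepting on a given product `σ` of the replies amounts to a measurement of the projection
`(1 + σ O) / 2`, where `O` is the product of the observables. -/
theorem Provers.acceptFrom_askList (q : V → Option Query) (target : ℤˣ) {l : List V}
    (hl : l.Nodup) (acc : ℤˣ) (φ : H) :
    P.acceptFrom (askList q target l acc) φ =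
      ‖φ + (((acc * target : ℤˣ) : ℤ) : ℂ) • P.listOp q l φ‖ ^ 2 / 4 := by
  induction l generalizing acc φ with
  | nil =>
    have h2 : ‖φ + φ‖ = 2 * ‖φ‖ := by rw [← two_smul ℂ φ, norm_smul]; simp
    simp only [askList, Provers.acceptFrom, Provers.listOp, List.map_nil, List.prod_nil]
    rcases Int.units_eq_one_or acc with rfl | rfl <;>
      rcases Int.units_eq_one_or target with rfl | rfl <;> simp [h2] <;> ring
  | cons v l ih =>
    obtain ⟨hv, hl⟩ := List.nodup_cons.1 hl
    cases hq : q v with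
    | none =>
      simp only [askList, hq]
      rw [ih hl]
      simp [Provers.listOp, hq]
    | some b =>
      simp only [askList, hq]
      rw [P.acceptFrom_ask, sum_congr rfl fun r _ => ih hl (acc * r) _, ← sum_div,
        ← P.sum_norm_proj_sq v b]
      congr 1
      refine sum_congr rfl fun r _ => ?_
      have h1 : ∀ χ, P.listOp q l (P.proj v b r χ) = P.proj v b r (P.listOp q l χ) := fun χ =>
        (congrArg (fun M : H →L[ℂ] H => M χ)
          (P.commute_proj (P.commute_listOp hv b) r).eq).symm
      have h2 : ∀ χ, P.proj v b r χ = ((r : ℤ) : ℂ) • P.proj v b r (P.obs v b χ) := by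
        intro χ
        rw [P.proj_apply, P.proj_apply, P.obs_obs_apply]
        rcases Int.units_eq_one_or r with rfl | rfl
        · simp [add_comm]
        · simp [add_comm]
      have h3 : P.listOp q (v :: l) φ = P.obs v b (P.listOp q l φ) := by
        simp [Provers.listOp, hq]
      have h4 : P.listOp q (v :: l) φ = P.listOp q l (P.obs v b φ) := by
        rw [h3]
        exact congrArg (fun M : H →L[ℂ] H => M φ) (P.commute_listOp hv b).eq
      rw [map_add, map_smul, h3, h1, h2 (P.listOp q l φ), smul_smul]
      congr 4
      rcases Int.units_eq_one_or r with rfl | rfl <;> simp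

end basics

/-! ### Words of observables -/

section words

variable {V : Type*} {H : Type*} [NormedAddCommGroup H] [InnerProductSpace ℂ H] [CompleteSpace H]
  (P : Provers V H)

/-- The product of the observables of prover `v` along a word of questions. -/
noncomputable def Provers.evalWord (v : V) : FreeMonoid Query →* (H →L[ℂ] H) :=
  FreeMonoid.lift (P.obs v)

@[simp] theorem Provers.evalWord_of (v : V) (b : Query) :
    P.evalWord v (FreeMonoid.of b) = P.obs v b := FreeMonoid.lift_eval_of _ _

theorem Provers.commute_evalWord_of_obs {v : V} {M : H →L[ℂ] H}
    (h : ∀ b, Commute (P.obs v b) M) (W : FreeMonoid Query) : Commute (P.evalWord v W) M := by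
  induction W with
  | one => simp
  | of b => simpa using h b
  | mul x y hx hy => rw [map_mul]; exact hx.mul_left hy

theorem Provers.pairwise_commute_evalWord :
    Pairwise fun v w => ∀ W W', Commute (P.evalWord v W) (P.evalWord w W') := fun v w h W W' =>
  P.commute_evalWord_of_obs
    (fun b => (P.commute_evalWord_of_obs (fun c => P.commute_obs w v h.symm c b) W').symm) W

theorem Provers.norm_evalWord (v : V) (W : FreeMonoid Query) (φ : H) :
    ‖P.evalWord v W φ‖ = ‖φ‖ := by
  induction W generalizing φ with
  | one => simp
  | of b => simp [P.norm_obs_apply]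
  | mul x y hx hy => simp [hx, hy]

variable [Fintype V]

/-- The product over all provers of the products of their observables along words of questions.
As observables of different provers commute, it is multiplicative in the family of words, which
reduces identities between such products to identities at each prover. -/
noncomputable def Provers.wordOp : (V → FreeMonoid Query) →* (H →L[ℂ] H) :=
  MonoidHom.noncommPiCoprod P.evalWord P.pairwise_commute_evalWord

theorem Provers.wordOp_apply (W : V → FreeMonoid Query) :
    P.wordOp W = univ.noncommProd (fun v => P.evalWord v (W v))
      fun _ _ _ _ h => P.pairwise_commute_evalWord h _ _ :=
  MonoidHom.noncommPiCoprod_apply _ _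

theorem Provers.wordOp_congr {W W' : V → FreeMonoid Query}
    (h : ∀ v, P.evalWord v (W v) = P.evalWord v (W' v)) : P.wordOp W = P.wordOp W' := by
  rw [P.wordOp_apply, P.wordOp_apply]
  exact noncommProd_congr rfl (fun v _ => h v) _

theorem Provers.wordOp_mulSingle [DecidableEq V] (v : V) (W : FreeMonoid Query) :
    P.wordOp (Pi.mulSingle v W) = P.evalWord v W :=
  MonoidHom.noncommPiCoprod_mulSingle _ _ _

theorem Provers.norm_wordOp (W : V → FreeMonoid Query) (φ : H) : ‖P.wordOp W φ‖ = ‖φ‖ := by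
  rw [P.wordOp_apply]
  refine noncommProd_induction _ _ _ (fun M : H →L[ℂ] H => ∀ φ, ‖M φ‖ = ‖φ‖)
    (fun M N hM hN φ => ?_) (by simp) (fun v _ => P.norm_evalWord v _) φ
  simp [hM, hN]

/-- The family of words in which each prover is asked at most the one question `q v`. -/
def queryWord (q : V → Option Query) : V → FreeMonoid Query := fun v => (q v).elim 1 FreeMonoid.of

/-- The product of the observables named by `q`. -/
noncomputable def Provers.queryOp (q : V → Option Query) : H →L[ℂ] H := P.wordOp (queryWord q)

theorem Provers.listOp_toList [DecidableEq V] (q : V → Option Query) :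
    P.listOp q univ.toList = P.queryOp q := by
  have h : ∀ v, P.evalWord v (queryWord q v) = (q v).elim 1 (P.obs v) := by
    intro v
    cases hq : q v <;> simp [queryWord, hq]
  rw [Provers.queryOp, P.wordOp_apply]
  unfold Provers.listOp
  simp only [← h]
  rw [← noncommProd_toFinset _ _ _ (nodup_toList univ)]
  · exact noncommProd_congr (toList_toFinset univ) (fun _ _ => rfl) _
  · exact fun v _ w _ hvw => P.pairwise_commute_evalWord hvw _ _

theorem Provers.accept_askProduct [DecidableEq V] (q : V → Option Query) (σ : ℤˣ) :
    P.accept (askProduct q σ) = ‖P.state + ((σ : ℤ) : ℂ) • P.queryOp q P.state‖ ^ 2 / 4 := by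
  rw [Provers.accept, askProduct, P.acceptFrom_askList q σ (nodup_toList univ), one_mul,
    P.listOp_toList]

/-- The probability of failing a test of a product of replies. -/
theorem Provers.one_sub_accept_askProduct [DecidableEq V] (q : V → Option Query) (σ : ℤˣ) :
    1 - P.accept (askProduct q σ) =
      ‖P.state - ((σ : ℤ) : ℂ) • P.queryOp q P.state‖ ^ 2 / 4 := by
  have h := parallelogram_law_with_norm ℂ P.state (((σ : ℤ) : ℂ) • P.queryOp q P.state)
  have hn : ‖((σ : ℤ) : ℂ) • P.queryOp q P.state‖ = 1 := by
    rw [norm_smul, Provers.queryOp, P.norm_wordOp, P.norm_state]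
    rcases Int.units_eq_one_or σ with rfl | rfl <;> simp
  rw [P.accept_askProduct]
  rw [hn, P.norm_state] at h
  linarith

end words

/-! ### The test for honesty as a sum of squared errors -/

section

variable {V : Type*} {H : Type*} [NormedAddCommGroup H] [InnerProductSpace ℂ H] [CompleteSpace H]
  (P : Provers V H)

/-- The anticommutator of the observables `X` and `Z` of the prover `v`. -/
noncomputable def Provers.anticomm (v : V) : H →L[ℂ] H :=
  P.obs v .X * P.obs v .Z + P.obs v .Z * P.obs v .X

theorem Provers.anticomm_apply (v : V) (φ : H) :
    P.anticomm v φ = P.obs v .X (P.obs v .Z φ) + P.obs v .Z (P.obs v .X φ) := rfl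

/-- The norm of `{X, Z} φ` is that of `Z X Z X φ + φ = Z X {X, Z} φ`. -/
theorem Provers.norm_anticomm (v : V) (φ : H) :
    ‖P.anticomm v φ‖ = ‖P.obs v .Z (P.obs v .X (P.obs v .Z (P.obs v .X φ))) + φ‖ := by
  rw [← P.norm_obs_apply v .X (P.anticomm v φ), ← P.norm_obs_apply v .Z (P.obs v .X _),
    P.anticomm_apply]
  simp only [map_add, P.obs_obs_apply]
  rw [add_comm]

end

theorem norm_apply_sub_le {H : Type*} [NormedAddCommGroup H] [InnerProductSpace ℂ H]
    {M N : H →L[ℂ] H} (hM : ∀ φ, ‖M φ‖ = ‖φ‖) (φ : H) :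
    ‖(M * N) φ - φ‖ ≤ ‖M φ - φ‖ + ‖N φ - φ‖ := by
  have h : (M * N) φ - φ = (M φ - φ) + M (N φ - φ) := by simp
  rw [h]
  exact (norm_add_le _ _).trans_eq (by rw [hM])

theorem exists_triangle_of_mem {V : Type*} [DecidableEq V] (G : SimpleGraph V)
    {τ : Finset V} (hτ : G.IsNClique 3 τ) {v : V} (hv : v ∈ τ) :
    ∃ a c, G.Adj a v ∧ G.Adj a c ∧ G.Adj v c ∧ τ = {a, v, c} := by
  obtain ⟨a, b, c, hab, hac, hbc, rfl⟩ := SimpleGraph.is3Clique_iff.1 hτ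
  simp only [mem_insert, mem_singleton] at hv
  rcases hv with rfl | rfl | rfl
  · exact ⟨b, c, hab.symm, hbc, hac, by rw [insert_comm]⟩
  · exact ⟨a, c, hab, hac, hbc, rfl⟩
  · exact ⟨a, b, hac, hab, hbc.symm, by rw [pair_comm]⟩

/-- For `r = 1` and `r = -1` the last terms on the right cancel. -/
theorem weighted_sq_norm_sub_eq {H : Type*} [NormedAddCommGroup H] [InnerProductSpace ℂ H]
    {a ξ ζ : H} {c s r : ℝ} (ha : ‖a‖ = 1) (hξ : ‖ξ‖ = 1)
    (hζ : ‖ζ‖ = 1) (hcs : c ^ 2 + s ^ 2 = 1) (hr : r ^ 2 = 1) :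
    c * ‖a - ξ‖ ^ 2 + s * ‖a - (r : ℂ) • ζ‖ ^ 2 =
      ‖a - ((c : ℂ) • ξ + ((r : ℂ) * (s : ℂ)) • ζ)‖ ^ 2 + 2 * (c + s) - 2 -
        2 * c * s * r * Complex.re (inner ℂ ξ ζ) := by
  rw [norm_sub_sq (𝕜 := ℂ), norm_sub_sq (𝕜 := ℂ), norm_sub_sq (𝕜 := ℂ),
    norm_add_sq (𝕜 := ℂ), inner_add_right, inner_smul_right, inner_smul_right, inner_smul_right,
    inner_smul_right, inner_smul_left]
  simp only [norm_smul, ha, hξ, hζ, norm_mul, Complex.norm_real, Real.norm_eq_abs, mul_one,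
    mul_pow, sq_abs, Complex.conj_ofReal, RCLike.re_to_complex, Complex.add_re,
    Complex.re_ofReal_mul, mul_assoc]
  linear_combination (s - s ^ 2) * hr - hcs

theorem numSubtests_pos (V : Type*) [Fintype V] [Nonempty V] (T : Finset (Finset V)) :
    0 < numSubtests V T := by
  have := Fintype.card_pos (α := V)
  unfold numSubtests
  omega

theorem cos_add_sin_mem {θ : ℝ} (hθ : 0 ≤ θ ∧ θ ≤ Real.pi / 2) :
    0 < Real.cos θ + Real.sin θ ∧ Real.cos θ + Real.sin θ ≤ 2 := by
  have hc := Real.cos_nonneg_of_mem_Icc ⟨by linarith [hθ.1, Real.pi_pos], hθ.2⟩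
  have hs := Real.sin_nonneg_of_nonneg_of_le_pi hθ.1 (by linarith [hθ.2, Real.pi_pos])
  exact ⟨by nlinarith [Real.cos_sq_add_sin_sq θ],
    by linarith [Real.cos_le_one θ, Real.sin_le_one θ]⟩

section test

variable {V : Type*} [Fintype V] [DecidableEq V] (G : SimpleGraph V) [DecidableRel G.Adj]
  {H : Type*} [NormedAddCommGroup H] [InnerProductSpace ℂ H] [CompleteSpace H] (P : Provers V H)

/-- The operator `Z^(A 1_v)`: the product of the observables `Z` of the neighbours of `v`. -/
noncomputable def Provers.neighborZ (v : V) : H →L[ℂ] H :=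
  P.wordOp fun w => if G.Adj v w then FreeMonoid.of .Z else 1

/-- The operator `X_u Z^(A 1_u ⊕ 1_v)`, which takes the place of `Z_v` on the graph state when `u`
is a neighbour of `v`. -/
noncomputable def Provers.linkOp (v u : V) : H →L[ℂ] H :=
  P.wordOp fun w => if w = v then 1 else if w = u then FreeMonoid.of .X
    else if G.Adj u w then FreeMonoid.of .Z else 1

/-- The stabilizer operator `X_v Z^(A 1_v)`. -/
noncomputable def Provers.stabilizer (v : V) : H →L[ℂ] H := P.queryOp (vertexQuery G v)

omit [DecidableEq V] in
theorem Provers.norm_neighborZ (v : V) (φ : H) : ‖P.neighborZ G v φ‖ = ‖φ‖ := P.norm_wordOp _ _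

theorem Provers.norm_linkOp (v u : V) (φ : H) : ‖P.linkOp G v u φ‖ = ‖φ‖ := P.norm_wordOp _ _

theorem Provers.norm_stabilizer (v : V) (φ : H) : ‖P.stabilizer G v φ‖ = ‖φ‖ := P.norm_wordOp _ _

theorem Provers.obs_eq_wordOp (v : V) (b : Query) :
    P.obs v b = P.wordOp (Pi.mulSingle v (FreeMonoid.of b)) := by
  rw [P.wordOp_mulSingle, P.evalWord_of]

theorem Provers.stabilizer_eq (v : V) : P.stabilizer G v = P.obs v .X * P.neighborZ G v := by
  rw [P.obs_eq_wordOp, Provers.neighborZ, ← map_mul]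
  refine congrArg P.wordOp (funext fun w => ?_)
  by_cases h : w = v
  · subst h; simp [queryWord, vertexQuery]
  · by_cases h' : G.Adj v w <;> simp [queryWord, vertexQuery, h, h']

theorem Provers.stabilizer_eq' (v : V) : P.stabilizer G v = P.neighborZ G v * P.obs v .X := by
  rw [P.obs_eq_wordOp, Provers.neighborZ, ← map_mul]
  refine congrArg P.wordOp (funext fun w => ?_)
  by_cases h : w = v
  · subst h; simp [queryWord, vertexQuery]
  · by_cases h' : G.Adj v w <;> simp [queryWord, vertexQuery, h, h']

theorem Provers.queryOp_rthetaXQuery (v : V) (t : ℤˣ) :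
    P.queryOp (rthetaXQuery G v t) = P.obs v (.R t) * P.neighborZ G v := by
  rw [P.obs_eq_wordOp, Provers.neighborZ, ← map_mul]
  refine congrArg P.wordOp (funext fun w => ?_)
  by_cases h : w = v
  · subst h; simp [queryWord, rthetaXQuery]
  · by_cases h' : G.Adj v w <;> simp [queryWord, rthetaXQuery, h, h']

theorem Provers.queryOp_rthetaZQuery (v u : V) (t : ℤˣ) :
    P.queryOp (rthetaZQuery G v u t) = P.obs v (.R t) * P.linkOp G v u := by
  rw [P.obs_eq_wordOp, Provers.linkOp, ← map_mul]
  refine congrArg P.wordOp (funext fun w => ?_)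
  by_cases h : w = v
  · subst h; simp [queryWord, rthetaZQuery]
  · by_cases h' : w = u
    · subst h'; simp [queryWord, rthetaZQuery, h]
    · by_cases h'' : G.Adj u w <;> simp [queryWord, rthetaZQuery, h, h', h'']

theorem Provers.stabilizer_eq_mul_linkOp {v u : V} (h : G.Adj v u) :
    P.stabilizer G u = P.obs v .Z * P.linkOp G v u := by
  rw [P.obs_eq_wordOp, Provers.linkOp, ← map_mul]
  refine congrArg P.wordOp (funext fun w => ?_)
  by_cases hw : w = v
  · subst hw; simp [queryWord, vertexQuery, h.ne, h.symm]
  · by_cases h' : w = u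
    · simp [queryWord, vertexQuery, h', h.ne']
    · by_cases h'' : G.Adj u w <;> simp [queryWord, vertexQuery, hw, h', h'']

/-- For a triangle `a b c`, the product of the three stabilizer operators and of the operator
tested in `TRIANGLE` is trivial at every vertex but `b`, where `X` and `Z` fail to cancel. -/
theorem Provers.stabilizer_mul_triangle {a b c : V} (hab : G.Adj a b) (hac : G.Adj a c)
    (hbc : G.Adj b c) :
    P.stabilizer G a * P.stabilizer G b * P.stabilizer G c *
        P.queryOp (triangleQuery G {a, b, c}) =
      P.obs b .Z * P.obs b .X * P.obs b .Z * P.obs b .X := by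
  have hb : P.obs b .Z * P.obs b .X * P.obs b .Z * P.obs b .X =
      P.evalWord b (.of .Z * .of .X * .of .Z * .of .X) := by simp
  rw [hb, ← P.wordOp_mulSingle]
  simp only [Provers.stabilizer, Provers.queryOp, ← map_mul]
  refine P.wordOp_congr fun w => ?_
  have hXX := P.obs_mul_self w .X
  have hZZ := P.obs_mul_self w .Z
  have hZZX : P.obs w .Z * P.obs w .Z * P.obs w .X * P.obs w .X = 1 := by
    rw [hZZ, one_mul, hXX]
  have hXZZX : P.obs w .X * P.obs w .Z * P.obs w .Z * P.obs w .X = 1 := by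
    rw [mul_assoc (P.obs w .X), hZZ, mul_one, hXX]
  by_cases h1 : w = b
  · subst h1
    simp [queryWord, vertexQuery, triangleQuery, hab, hbc.symm, hab.ne', hbc.ne]
  by_cases h2 : w = a
  · subst h2
    simp [queryWord, vertexQuery, triangleQuery, hab.symm, hac.symm, hac.ne, h1, hXZZX]
  by_cases h3 : w = c
  · subst h3
    simp [queryWord, vertexQuery, triangleQuery, hac, hbc, h2, h1, hZZX]
  by_cases ha : G.Adj a w <;> by_cases hb' : G.Adj b w <;> by_cases hc : G.Adj c w <;>
    simp [queryWord, vertexQuery, triangleQuery, h1, h2, h3, ha, hb', hc, filter_insert,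
      filter_singleton, hab.ne, hac.ne, hbc.ne, hZZ, mul_assoc, Nat.odd_iff]

theorem Provers.norm_stabilizer_triple_sub_le (a b c : V) (φ : H) :
    ‖(P.stabilizer G a * P.stabilizer G b * P.stabilizer G c) φ - φ‖ ≤
      ‖P.stabilizer G a φ - φ‖ + ‖P.stabilizer G b φ - φ‖ + ‖P.stabilizer G c φ - φ‖ := by
  refine (norm_apply_sub_le (fun φ => ?_) φ).trans ?_
  · simp [P.norm_stabilizer G]
  · gcongr
    exact norm_apply_sub_le (P.norm_stabilizer G a) φ

/-- The anticommutator and the error in `TRIANGLE` agree up to the errors in `VERTEX`. -/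
theorem Provers.abs_norm_anticomm_sub_le {a b c : V} (hab : G.Adj a b) (hac : G.Adj a c)
    (hbc : G.Adj b c) (φ : H) :
    |‖P.anticomm b φ‖ - ‖P.queryOp (triangleQuery G {a, b, c}) φ + φ‖| ≤
      ‖P.stabilizer G a φ - φ‖ + ‖P.stabilizer G b φ - φ‖ + ‖P.stabilizer G c φ - φ‖ := by
  refine le_trans ?_ (P.norm_stabilizer_triple_sub_le G a b c φ)
  set S := P.stabilizer G a * P.stabilizer G b * P.stabilizer G c with hS
  set O := P.queryOp (triangleQuery G {a, b, c}) with hO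
  have hSn : ∀ χ, ‖S χ‖ = ‖χ‖ := fun χ => by simp [hS, P.norm_stabilizer G]
  have h : S (O φ) = P.obs b .Z (P.obs b .X (P.obs b .Z (P.obs b .X φ))) :=
    congrArg (fun M : H →L[ℂ] H => M φ) (P.stabilizer_mul_triangle G hab hac hbc)
  rw [P.norm_anticomm, ← h, ← hSn (O φ + φ), map_add]
  refine (abs_norm_sub_norm_le _ _).trans_eq ?_
  rw [add_sub_add_left_eq_sub, norm_sub_rev]

/-- The error in `RTHETA`: the difference between `R(t θ) ψ` and the combination
`cos θ Z^(A 1_v) ψ + t sin θ X_u Z^(A 1_u ⊕ 1_v) ψ` that equals it for the honest provers. -/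
noncomputable def Provers.rthetaError (v u : V) (θ : ℝ) (t : ℤˣ) : H :=
  P.obs v (.R t) P.state - ((Real.cos θ : ℂ) • P.neighborZ G v P.state +
    (((t : ℤ) : ℂ) * (Real.sin θ : ℂ)) • P.linkOp G v u P.state)

/-- The failure probabilities in `RTHETA` for a vertex, over both signs, exceed their least
possible value by the squares of the errors: the cross terms for `t = 1` and `t = -1` cancel, so no
relation between the operators at `v` and at the other vertices is involved. -/
theorem Provers.rtheta_deficit (v u : V) {θ : ℝ} (hc : 0 ≤ Real.cos θ) (hs : 0 ≤ Real.sin θ) :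
    1 + 1 / (Real.cos θ + |Real.sin θ|) - ∑ t, rthetaAccept G v u θ t P =
      (∑ t, ‖P.rthetaError G v u θ t‖ ^ 2) / (4 * (Real.cos θ + Real.sin θ)) := by
  have hcs := Real.cos_sq_add_sin_sq θ
  have hpos : 0 < Real.cos θ + Real.sin θ := by nlinarith
  have key : ∀ t : ℤˣ, ((t : ℤ) : ℝ) ^ 2 = 1 := fun t => by
    rcases Int.units_eq_one_or t with rfl | rfl <;> simp
  have hX : ∀ t : ℤˣ, P.accept (askProduct (rthetaXQuery G v t) 1) =
      1 - ‖P.obs v (.R t) P.state - P.neighborZ G v P.state‖ ^ 2 / 4 := by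
    intro t
    have := P.one_sub_accept_askProduct (rthetaXQuery G v t) 1
    rw [P.queryOp_rthetaXQuery G, ← P.norm_obs_apply v (.R t)] at this
    simp only [Units.val_one, Int.cast_one, one_smul, map_sub, mul_apply_eq_comp,
      P.obs_obs_apply] at this
    linarith
  have hZ : ∀ t : ℤˣ, P.accept (askProduct (rthetaZQuery G v u t) t) =
      1 - ‖P.obs v (.R t) P.state - (((t : ℤ) : ℝ) : ℂ) • P.linkOp G v u P.state‖ ^ 2 / 4 := by
    intro t
    have := P.one_sub_accept_askProduct (rthetaZQuery G v u t) t
    rw [P.queryOp_rthetaZQuery G, ← P.norm_obs_apply v (.R t)] at this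
    simp only [map_sub, map_smul, mul_apply_eq_comp, P.obs_obs_apply] at this
    push_cast
    linarith
  have hw : ∀ t : ℤˣ, _ := fun t => weighted_sq_norm_sub_eq (a := P.obs v (.R t) P.state)
    (ξ := P.neighborZ G v P.state) (ζ := P.linkOp G v u P.state)
    (by rw [P.norm_obs_apply, P.norm_state]) (by rw [P.norm_neighborZ G, P.norm_state])
    (by rw [P.norm_linkOp G, P.norm_state]) hcs (key t)
  have h1 := hw 1
  have h2 := hw (-1)
  simp only [rthetaAccept, hX, hZ, abs_of_nonneg hs, sum_intUnits, Provers.rthetaError]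
  simp only [Units.val_one, Int.cast_one, Units.val_neg, Int.cast_neg, Complex.ofReal_one,
    Complex.ofReal_neg] at h1 h2 ⊢
  clear hw hX hZ
  simp only [one_mul, neg_one_mul] at h1 h2 ⊢
  generalize Real.cos θ = c at *
  generalize Real.sin θ = s at *
  field_simp
  linarith

/-- The probability of passing the test for honesty is `c_test` less a sum of squares, which vanish
for the honest provers. -/
theorem Provers.cTest_sub_testAccept [Nonempty V] (T : Finset (Finset V)) (u : V → V) {θ : V → ℝ}
    (hθ : ∀ v, 0 ≤ θ v ∧ θ v ≤ Real.pi / 2) :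
    numSubtests V T * (cTest T θ - testAccept G T u θ P) =
      ∑ v, ‖P.stabilizer G v P.state - P.state‖ ^ 2 / 4 +
      ∑ τ ∈ T, ‖P.queryOp (triangleQuery G τ) P.state + P.state‖ ^ 2 / 4 +
      ∑ v, (∑ t, ‖P.rthetaError G v (u v) (θ v) t‖ ^ 2) /
        (4 * (Real.cos (θ v) + Real.sin (θ v))) := by
  have h1 : ∀ v, ‖P.stabilizer G v P.state - P.state‖ ^ 2 / 4 =
      1 - P.accept (askProduct (vertexQuery G v) 1) := by
    intro v
    rw [P.one_sub_accept_askProduct, norm_sub_rev]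
    simp [Provers.stabilizer]
  have h2 : ∀ τ, ‖P.queryOp (triangleQuery G τ) P.state + P.state‖ ^ 2 / 4 =
      1 - P.accept (askProduct (triangleQuery G τ) (-1)) := by
    intro τ
    rw [P.one_sub_accept_askProduct]
    simp [add_comm]
  have h3 : ∀ v, _ := fun v => P.rtheta_deficit G v (u v) (θ := θ v)
    (Real.cos_nonneg_of_mem_Icc ⟨by linarith [(hθ v).1, Real.pi_pos], (hθ v).2⟩)
    (Real.sin_nonneg_of_nonneg_of_le_pi (hθ v).1 (by linarith [(hθ v).2, Real.pi_pos]))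
  simp only [h1, h2, ← h3, sum_sub_distrib, sum_add_distrib]
  have hV : (Fintype.card V : ℝ) ≠ 0 := by simp
  have hN : (numSubtests V T : ℝ) ≠ 0 := by exact_mod_cast (numSubtests_pos V T).ne'
  rw [testAccept, cTest, ← mul_sum, sum_comm (s := univ (α := ℤˣ))]
  have hT : (T.card : ℝ) / numSubtests V T *
      (1 / (T.card : ℝ) * ∑ τ ∈ T, P.accept (askProduct (triangleQuery G τ) (-1))) =
      (∑ τ ∈ T, P.accept (askProduct (triangleQuery G τ) (-1))) / numSubtests V T := by
    rcases T.eq_empty_or_nonempty with rfl | hne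
    · simp
    · have : (T.card : ℝ) ≠ 0 := by simpa using hne.ne_empty
      field_simp
  rw [hT]
  simp only [sum_const, nsmul_eq_mul, card_univ, mul_one]
  field_simp
  ring

/-- No provers pass the test for honesty with probability larger than `c_test`. -/
theorem Provers.testAccept_le_cTest [Nonempty V] (T : Finset (Finset V)) (u : V → V) {θ : V → ℝ}
    (hθ : ∀ v, 0 ≤ θ v ∧ θ v ≤ Real.pi / 2) : testAccept G T u θ P ≤ cTest T θ := by
  have h := P.cTest_sub_testAccept G T u hθ
  have hr : 0 ≤ ∑ v, (∑ t, ‖P.rthetaError G v (u v) (θ v) t‖ ^ 2) /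
      (4 * (Real.cos (θ v) + Real.sin (θ v))) :=
    sum_nonneg fun v _ => div_nonneg (by positivity)
      (mul_nonneg (by norm_num) (cos_add_sin_mem (hθ v)).1.le)
  have hN := numSubtests_pos V T
  by_contra! hlt
  have h0 : (numSubtests V T : ℝ) * (cTest T θ - testAccept G T u θ P) < 0 :=
    mul_neg_of_pos_of_neg (by exact_mod_cast hN) (by linarith)
  have h1 : 0 ≤ ∑ v, ‖P.stabilizer G v P.state - P.state‖ ^ 2 / 4 := by positivity
  have h2 : 0 ≤ ∑ τ ∈ T, ‖P.queryOp (triangleQuery G τ) P.state + P.state‖ ^ 2 / 4 := by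
    positivity
  linarith

/-- Provers that pass the test for honesty with probability close to `c_test` make a small error in
each subtest. -/
theorem Provers.errors_le [Nonempty V] {T : Finset (Finset V)} {u : V → V} {θ : V → ℝ}
    (hθ : ∀ v, 0 ≤ θ v ∧ θ v ≤ Real.pi / 2) {η : ℝ} (hη : 0 ≤ η)
    (h : numSubtests V T * (cTest T θ - testAccept G T u θ P) ≤ η ^ 2) :
    (∀ v, ‖P.stabilizer G v P.state - P.state‖ ≤ 2 * η) ∧
    (∀ τ ∈ T, ‖P.queryOp (triangleQuery G τ) P.state + P.state‖ ≤ 2 * η) ∧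
    (∀ v t, ‖P.rthetaError G v (u v) (θ v) t‖ ≤ 3 * η) := by
  rw [P.cTest_sub_testAccept G T u hθ] at h
  have hr : ∀ v, 0 ≤ (∑ t, ‖P.rthetaError G v (u v) (θ v) t‖ ^ 2) /
      (4 * (Real.cos (θ v) + Real.sin (θ v))) := fun v =>
    div_nonneg (by positivity) (mul_nonneg (by norm_num) (cos_add_sin_mem (hθ v)).1.le)
  have h1 : 0 ≤ ∑ v, ‖P.stabilizer G v P.state - P.state‖ ^ 2 / 4 := by positivity
  have h2 : 0 ≤ ∑ τ ∈ T, ‖P.queryOp (triangleQuery G τ) P.state + P.state‖ ^ 2 / 4 := by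
    positivity
  have h3 := sum_nonneg fun v (_ : v ∈ univ) => hr v
  refine ⟨fun v => ?_, fun τ hτ => ?_, fun v t => ?_⟩
  · have := single_le_sum (f := fun v => ‖P.stabilizer G v P.state - P.state‖ ^ 2 / 4)
      (fun v _ => by positivity) (mem_univ v)
    exact (sq_le_sq₀ (norm_nonneg _) (by positivity)).1 (by linarith)
  · have := single_le_sum
      (f := fun τ => ‖P.queryOp (triangleQuery G τ) P.state + P.state‖ ^ 2 / 4)
      (fun τ _ => by positivity) hτ
    exact (sq_le_sq₀ (norm_nonneg _) (by positivity)).1 (by linarith)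
  · have hv := single_le_sum (f := fun v => (∑ t, ‖P.rthetaError G v (u v) (θ v) t‖ ^ 2) /
      (4 * (Real.cos (θ v) + Real.sin (θ v)))) (fun v _ => hr v) (mem_univ v)
    have ht := single_le_sum (f := fun t => ‖P.rthetaError G v (u v) (θ v) t‖ ^ 2)
      (fun t _ => by positivity) (mem_univ t)
    obtain ⟨hp, hle⟩ := cos_add_sin_mem (hθ v)
    have hv' := hv.trans (by linarith : _ ≤ η ^ 2)
    rw [div_le_iff₀ (by positivity)] at hv'
    have : η ^ 2 * (4 * (Real.cos (θ v) + Real.sin (θ v))) ≤ η ^ 2 * (4 * 2) := by gcongr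
    refine (sq_le_sq₀ (norm_nonneg _) (by positivity)).1 ?_
    nlinarith [sq_nonneg η]

/-- The difference `R(t θ_v) - (cos θ_v X_v + t sin θ_v Z_v)`, which vanishes for the honest
provers. -/
noncomputable def Provers.rotationError (θ : V → ℝ) (v : V) (t : ℤˣ) : H →L[ℂ] H :=
  P.obs v (.R t) - ((Real.cos (θ v) : ℂ) • P.obs v .X +
    (((t : ℤ) : ℂ) * (Real.sin (θ v) : ℂ)) • P.obs v .Z)

/-- The error in `RTHETA` and the failure of `R(t θ_v)` to be the combination of `X_v` and `Z_v`
agree up to the errors in `VERTEX`. -/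
theorem Provers.norm_rthetaError_sub_le (θ : V → ℝ) {v u : V} (h : G.Adj v u) (t : ℤˣ) :
    ‖P.rthetaError G v u (θ v) t - P.rotationError θ v t P.state‖ ≤
      ‖P.stabilizer G v P.state - P.state‖ + ‖P.stabilizer G u P.state - P.state‖ := by
  have hX : ‖P.obs v .X P.state - P.neighborZ G v P.state‖ =
      ‖P.stabilizer G v P.state - P.state‖ := by
    rw [← P.norm_obs_apply v .X, map_sub, P.obs_obs_apply, norm_sub_rev, P.stabilizer_eq G]
    rfl
  have hZ : ‖P.obs v .Z P.state - P.linkOp G v u P.state‖ =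
      ‖P.stabilizer G u P.state - P.state‖ := by
    rw [← P.norm_obs_apply v .Z, map_sub, P.obs_obs_apply, norm_sub_rev,
      P.stabilizer_eq_mul_linkOp G h]
    rfl
  have heq : P.rthetaError G v u (θ v) t - P.rotationError θ v t P.state =
      (Real.cos (θ v) : ℂ) • (P.obs v .X P.state - P.neighborZ G v P.state) +
      (((t : ℤ) : ℂ) * (Real.sin (θ v) : ℂ)) •
        (P.obs v .Z P.state - P.linkOp G v u P.state) := by
    simp only [Provers.rthetaError, Provers.rotationError, sub_apply,
      add_apply, smul_apply]
    module
  have hc : ‖(Real.cos (θ v) : ℂ)‖ ≤ 1 := by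
    rw [Complex.norm_real]; exact Real.abs_cos_le_one _
  have hs : ‖((t : ℤ) : ℂ) * (Real.sin (θ v) : ℂ)‖ ≤ 1 := by
    have : ‖((t : ℤ) : ℂ)‖ = 1 := by rcases Int.units_eq_one_or t with rfl | rfl <;> simp
    rw [norm_mul, this, one_mul, Complex.norm_real]; exact Real.abs_sin_le_one _
  rw [heq, ← hX, ← hZ]
  refine (norm_add_le _ _).trans ?_
  rw [norm_smul, norm_smul]
  gcongr
  · exact mul_le_of_le_one_left (norm_nonneg _) hc
  · exact mul_le_of_le_one_left (norm_nonneg _) hs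

end test

/-! ### Qubit registers with coefficients in a Hilbert space -/

/-- The tensor product of one qubit for each `v : V` with a Hilbert space `H`, as the space of
families of vectors of `H` indexed by the computational basis. -/
abbrev Register (V H : Type*) := PiLp 2 fun _ : V → Fin 2 => H

section register

variable {V : Type*} [DecidableEq V] {H : Type*} [NormedAddCommGroup H] [InnerProductSpace ℂ H]

/-- The qubit operator `M` acting on the qubit `v` of a register. -/
noncomputable def registerOp (v : V) (M : Matrix (Fin 2) (Fin 2) ℂ) :
    Register V H →L[ℂ] Register V H :=
  ((PiLp.continuousLinearEquiv 2 ℂ fun _ : V → Fin 2 => H).symm :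
      (∀ _ : V → Fin 2, H) →L[ℂ] Register V H) ∘L
    ContinuousLinearMap.pi fun x =>
      ∑ a, M (x v) a • PiLp.proj (𝕜 := ℂ) 2 (fun _ : V → Fin 2 => H) (Function.update x v a)

theorem registerOp_apply (v : V) (M : Matrix (Fin 2) (Fin 2) ℂ) (f : Register V H)
    (x : V → Fin 2) : registerOp v M f x = ∑ a, M (x v) a • f (Function.update x v a) := by
  simp [registerOp]

theorem registerOp_mul (v : V) (M N : Matrix (Fin 2) (Fin 2) ℂ) :
    registerOp (H := H) v M * registerOp v N = registerOp v (M * N) := by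
  ext f x
  simp only [mul_apply_eq_comp, registerOp_apply, Function.update_self,
    Function.update_idem, Matrix.mul_apply, Finset.sum_smul, Finset.smul_sum]
  rw [Finset.sum_comm]
  simp only [smul_smul]

theorem registerOp_one (v : V) : registerOp (H := H) v 1 = 1 := by
  ext f x
  simp [registerOp_apply, Matrix.one_apply]

theorem registerOp_commute {v w : V} (h : v ≠ w) (M N : Matrix (Fin 2) (Fin 2) ℂ) :
    Commute (registerOp (H := H) v M) (registerOp w N) := by
  ext f x
  simp only [mul_apply_eq_comp, registerOp_apply, Function.update_of_ne h,
    Function.update_of_ne h.symm, Finset.smul_sum]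
  rw [Finset.sum_comm]
  refine Finset.sum_congr rfl fun a _ => Finset.sum_congr rfl fun b _ => ?_
  rw [Function.update_comm h, smul_comm]

theorem add_single_eq_update (x : V → Fin 2) (v : V) :
    x + Pi.single v 1 = Function.update x v (x v + 1) := by
  ext w
  by_cases h : w = v
  · subst h; simp
  · simp [h]

theorem pauliX_sum {E : Type*} [AddCommGroup E] [Module ℂ E] (v : V) (f : (V → Fin 2) → E)
    (x : V → Fin 2) :
    ∑ a, pauliX (x v) a • f (Function.update x v a) = f (x + Pi.single v 1) := by
  rw [add_single_eq_update, Fin.sum_univ_two]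
  generalize x v = a
  fin_cases a <;> simp [pauliX]

theorem pauliZ_sum {E : Type*} [AddCommGroup E] [Module ℂ E] (v : V) (f : (V → Fin 2) → E)
    (x : V → Fin 2) :
    ∑ a, pauliZ (x v) a • f (Function.update x v a) = (-1 : ℂ) ^ (x v : ℕ) • f x := by
  rcases (by decide : ∀ a : Fin 2, a = 0 ∨ a = 1) (x v) with h | h
  all_goals
    have hx := Function.update_eq_self v x
    rw [h] at hx
    simp [Fin.sum_univ_two, pauliZ, h, hx]

theorem registerOp_pauliX_apply (v : V) (f : Register V H) (x : V → Fin 2) :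
    registerOp v pauliX f x = f (x + Pi.single v 1) := by
  rw [registerOp_apply, pauliX_sum v f x]

theorem registerOp_pauliZ_apply (v : V) (f : Register V H) (x : V → Fin 2) :
    registerOp v pauliZ f x = (-1 : ℂ) ^ (x v : ℕ) • f x := by
  rw [registerOp_apply, pauliZ_sum v f x]

variable [Fintype V]

theorem registerOp_add (v : V) (M N : Matrix (Fin 2) (Fin 2) ℂ) :
    registerOp (H := H) v (M + N) = registerOp v M + registerOp v N := by
  ext f x
  simp only [add_apply, PiLp.add_apply, registerOp_apply, Matrix.add_apply, add_smul,
    sum_add_distrib]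

theorem registerOp_smul (v : V) (c : ℂ) (M : Matrix (Fin 2) (Fin 2) ℂ) :
    registerOp (H := H) v (c • M) = c • registerOp v M := by
  ext f x
  simp only [smul_apply, PiLp.smul_apply, registerOp_apply, Matrix.smul_apply, smul_eq_mul,
    mul_smul, smul_sum]

theorem registerOp_isSelfAdjoint [CompleteSpace H] (v : V) {M : Matrix (Fin 2) (Fin 2) ℂ}
    (hM : M.IsHermitian) : IsSelfAdjoint (registerOp (H := H) v M) := by
  rw [ContinuousLinearMap.isSelfAdjoint_iff_isSymmetric]
  intro f g
  simp only [ContinuousLinearMap.coe_coe, PiLp.inner_apply, registerOp_apply, sum_inner, inner_sum,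
    inner_smul_left, inner_smul_right]
  rw [← Fintype.sum_prod_type' (f := fun (x : V → Fin 2) (a : Fin 2) =>
      (starRingEnd ℂ) (M (x v) a) * inner ℂ (f (Function.update x v a)) (g x)),
    ← Fintype.sum_prod_type' (f := fun (x : V → Fin 2) (a : Fin 2) =>
      M (x v) a * inner ℂ (f x) (g (Function.update x v a)))]
  refine Fintype.sum_equiv
    { toFun := fun p => (Function.update p.1 v p.2, p.1 v)
      invFun := fun p => (Function.update p.1 v p.2, p.1 v)
      left_inv := fun p => by simp
      right_inv := fun p => by simp } _ _ ?_
  rintro ⟨x, a⟩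
  have := hM.apply a (x v)
  simp only [Equiv.coe_fn_mk, Function.update_self, Function.update_idem, Function.update_eq_self]
  rw [← this, RCLike.star_def]

theorem localOp_pauliX_apply (v : V) (φ : EuclideanSpace ℂ (V → Fin 2)) (x : V → Fin 2) :
    localOp (D := fun _ => Fin 2) v pauliX φ x = φ (x + Pi.single v 1) := by
  rw [localOp_apply, ← pauliX_sum v φ x]
  rfl

theorem localOp_pauliZ_apply (v : V) (φ : EuclideanSpace ℂ (V → Fin 2)) (x : V → Fin 2) :
    localOp (D := fun _ => Fin 2) v pauliZ φ x = (-1 : ℂ) ^ (x v : ℕ) * φ x := by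
  rw [localOp_apply, ← smul_eq_mul, ← pauliZ_sum v φ x]
  rfl

theorem registerOp_rotR (v : V) (θ : ℝ) (t : ℤˣ) :
    registerOp (H := H) v (idealObs θ (.R t)) = (Real.cos θ : ℂ) • registerOp v pauliX +
      (((t : ℤ) : ℂ) * (Real.sin θ : ℂ)) • registerOp v pauliZ := by
  rw [idealObs, rotR, registerOp_add, registerOp_smul, registerOp_smul]
  rcases Int.units_eq_one_or t with rfl | rfl <;> simp

/-- The tensor product of a state of the qubits with a vector of the coefficient space. -/
noncomputable def tensorVec (φ : EuclideanSpace ℂ (V → Fin 2)) (χ : H) : Register V H :=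
  WithLp.toLp 2 fun x => φ x • χ

theorem norm_tensorVec (φ : EuclideanSpace ℂ (V → Fin 2)) (χ : H) :
    ‖tensorVec φ χ‖ = ‖φ‖ * ‖χ‖ := by
  rw [← sq_eq_sq₀ (norm_nonneg _) (by positivity), mul_pow, PiLp.norm_sq_eq_of_L2,
    EuclideanSpace.norm_sq_eq, sum_mul]
  simp [tensorVec, norm_smul, mul_pow]

theorem sum_add_right_eq (s : V → Fin 2) (F : (V → Fin 2) → ℝ) : ∑ x, F (x + s) = ∑ x, F x :=
  Equiv.sum_comp (Equiv.addRight s) F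

theorem two_mul_sum_eq_sum_add_single (v : V) (F : (V → Fin 2) → ℝ) :
    2 * ∑ x, F x = ∑ x, (F x + F (x + Pi.single v 1)) := by
  rw [sum_add_distrib, sum_add_right_eq, two_mul]

variable [CompleteSpace H]

/-- Provers that hold the qubits of a register and measure them with the ideal observables. -/
noncomputable def idealProvers (θ : V → ℝ) (f : Register V H) (hf : ‖f‖ = 1) :
    Provers V (Register V H) where
  state := f
  norm_state := hf
  obs := fun v b => registerOp v (idealObs (θ v) b)
  isSelfAdjoint_obs := fun v b => registerOp_isSelfAdjoint v (idealObs_isHermitian (θ v) b)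
  obs_mul_self := fun v b => by rw [registerOp_mul, idealObs_mul_self, registerOp_one]
  commute_obs := fun _ _ h _ _ => registerOp_commute h _ _

/-- A measurement of the qubits of `φ ⊗ χ` proceeds as it does on `φ`. -/
theorem idealProvers_acceptFrom_tensorVec (G : SimpleGraph V) [DecidableRel G.Adj] (θ : V → ℝ)
    (f : Register V H) (hf : ‖f‖ = 1) (A : AdaptiveMeasurement V)
    (φ : EuclideanSpace ℂ (V → Fin 2)) (χ : H) :
    (idealProvers θ f hf).acceptFrom A (tensorVec φ χ) =
      (honest G θ).acceptFrom A φ * ‖χ‖ ^ 2 := by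
  induction A generalizing φ with
  | halt a => cases a <;> simp [Provers.acceptFrom, norm_tensorVec, mul_pow]
  | ask v b next ih =>
    rw [Provers.acceptFrom_ask, Provers.acceptFrom_ask, sum_mul]
    refine sum_congr rfl fun r _ => ?_
    rw [← ih]
    congr 1
    ext x
    have h1 : (idealProvers θ f hf).obs v b (tensorVec φ χ) x =
        (honest G θ).obs v b φ x • χ := by
      change registerOp v (idealObs (θ v) b) (tensorVec φ χ) x =
        localOp (D := fun _ => Fin 2) v (idealObs (θ v) b) φ x • χ
      rw [registerOp_apply, localOp_apply, sum_smul]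
      simp [tensorVec, mul_smul]
    rw [Provers.proj_apply, PiLp.smul_apply, PiLp.add_apply, PiLp.smul_apply, h1]
    simp only [tensorVec, Provers.proj_apply, PiLp.smul_apply, PiLp.add_apply, smul_eq_mul,
      mul_smul, add_smul]

end register

/-! ### The swap isometry -/

section swap

variable {V : Type*} {H : Type*} [NormedAddCommGroup H] [InnerProductSpace ℂ H] [CompleteSpace H]
  (P : Provers V H)

/-- The operator `X^a (1 + (-1)^a Z) / 2` of the prover `v`. When `X` and `Z` anticommute, it is
`|0⟩⟨a|` on the qubit that they act on. -/
noncomputable def Provers.extract (v : V) (a : Fin 2) : H →L[ℂ] H :=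
  (if a = 0 then 1 else P.obs v .X) * ((1 / 2 : ℂ) • (1 + (-1 : ℂ) ^ (a : ℕ) • P.obs v .Z))

theorem Provers.commute_extract {v : V} {M : H →L[ℂ] H} (h : ∀ b, Commute (P.obs v b) M)
    (a : Fin 2) : Commute (P.extract v a) M := by
  refine Commute.mul_left ?_
    (((Commute.one_left M).add_left ((h .Z).smul_left _)).smul_left _)
  split_ifs
  exacts [Commute.one_left M, h .X]

theorem Provers.commute_extract_extract {v w : V} (h : v ≠ w) (a b : Fin 2) :
    Commute (P.extract v a) (P.extract w b) :=
  P.commute_extract (fun c => (P.commute_extract (fun d => P.commute_obs w v h.symm d c) b).symm) a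

theorem Provers.sum_norm_extract_sq (v : V) (φ : H) : ∑ a, ‖P.extract v a φ‖ ^ 2 = ‖φ‖ ^ 2 := by
  have h := P.sum_norm_proj_sq v .Z φ
  rw [sum_intUnits] at h
  have h0 : P.extract v 0 φ = P.proj v .Z 1 φ := by simp [Provers.extract, Provers.proj]
  have h1 : P.extract v 1 φ = P.obs v .X (P.proj v .Z (-1) φ) := by
    simp [Provers.extract, Provers.proj]
  rw [← h, Fin.sum_univ_two, h0, h1, P.norm_obs_apply]

theorem Provers.extract_obs_Z (v : V) (a : Fin 2) :
    P.extract v a * P.obs v .Z = (-1 : ℂ) ^ (a : ℕ) • P.extract v a := by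
  have h := P.obs_mul_self v .Z
  fin_cases a
  · simp [Provers.extract, add_mul, h, add_comm]
  · simp [Provers.extract, add_mul, mul_add, mul_assoc, h, add_comm]

theorem Provers.norm_extract_obs_X_sub (v : V) (a : Fin 2) (φ : H) :
    ‖P.extract v a (P.obs v .X φ) - P.extract v (a + 1) φ‖ = ‖P.anticomm v φ‖ / 2 := by
  fin_cases a
  · have : P.extract v 0 (P.obs v .X φ) - P.extract v 1 φ =
        (1 / 2 : ℂ) • P.anticomm v φ := by
      simp only [Provers.extract, P.anticomm_apply]
      simp
      module
    simp only [Fin.zero_eta, Fin.isValue, zero_add]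
    rw [this, norm_smul]
    norm_num
    ring
  · have : P.extract v 1 (P.obs v .X φ) - P.extract v 0 φ =
        -((1 / 2 : ℂ) • P.obs v .X (P.anticomm v φ)) := by
      simp only [Provers.extract, P.anticomm_apply]
      simp [P.obs_obs_apply]
      module
    simp only [Fin.mk_one, Fin.isValue, Fin.reduceAdd]
    rw [this, norm_neg, norm_smul, P.norm_obs_apply]
    norm_num
    ring

/-- The product of the operators `extract v (x v)` for the provers `v` in `s`. -/
noncomputable def Provers.extractOn (s : Finset V) (x : V → Fin 2) : H →L[ℂ] H :=
  s.noncommProd (fun v => P.extract v (x v)) fun _ _ _ _ h => P.commute_extract_extract h _ _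

variable [DecidableEq V]

theorem Provers.extractOn_insert {s : Finset V} {v : V} (hv : v ∉ s) (x : V → Fin 2) :
    P.extractOn (insert v s) x = P.extract v (x v) * P.extractOn s x :=
  noncommProd_insert_of_notMem _ _ _ _ hv

theorem Provers.extractOn_add_single {s : Finset V} {v : V} (hv : v ∉ s) (x : V → Fin 2) :
    P.extractOn s (x + Pi.single v 1) = P.extractOn s x := by
  refine noncommProd_congr rfl (fun w hw => ?_) _
  have : w ≠ v := fun h => hv (h ▸ hw)
  simp [this]

variable [Fintype V]

/-- The operators `extract v 0` and `extract v 1` form an isometry into two copies of the space;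
each prover of `s` contributes one of these. -/
theorem Provers.sum_norm_extractOn_sq (s : Finset V) (y : (V → Fin 2) → H)
    (hy : ∀ v ∈ s, ∀ x, y (x + Pi.single v 1) = y x) :
    2 ^ s.card * ∑ x, ‖P.extractOn s x (y x)‖ ^ 2 = ∑ x, ‖y x‖ ^ 2 := by
  induction s using Finset.induction_on with
  | empty =>
    have h : ∀ x, P.extractOn ∅ x = 1 := fun x => noncommProd_empty _ _
    simp [h]
  | insert v s hv ih =>
    rw [← ih fun w hw => hy w (mem_insert_of_mem hw), card_insert_of_notMem hv, pow_succ, mul_assoc]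
    congr 1
    rw [two_mul_sum_eq_sum_add_single v]
    refine sum_congr rfl fun x _ => ?_
    rw [P.extractOn_insert hv, P.extractOn_insert hv, P.extractOn_add_single hv,
      hy v (mem_insert_self v s), ← P.sum_norm_extract_sq v (P.extractOn s x (y x)),
      Fin.sum_univ_two]
    simp only [mul_apply_eq_comp, Pi.add_apply, Pi.single_eq_same]
    generalize x v = a
    fin_cases a <;> simp [add_comm]

/-- The isometry `φ ↦ ∑_x |x⟩ ⊗ ∏_v X_v^(x v) (1 + (-1)^(x v) Z_v) / 2 φ`, which swaps the qubits
that the provers act on into a register of qubits. -/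
noncomputable def Provers.swap : H →ₗ[ℂ] Register V H where
  toFun φ := WithLp.toLp 2 fun x => P.extractOn univ x φ
  map_add' φ χ := by ext x; simp
  map_smul' c φ := by ext x; simp

omit [DecidableEq V] in
theorem Provers.swap_apply (φ : H) (x : V → Fin 2) : P.swap φ x = P.extractOn univ x φ := rfl

theorem Provers.norm_swap (φ : H) : ‖P.swap φ‖ = ‖φ‖ := by
  have h := P.sum_norm_extractOn_sq univ (fun _ => φ) fun _ _ _ => rfl
  rw [← sq_eq_sq₀ (norm_nonneg _) (norm_nonneg _), PiLp.norm_sq_eq_of_L2]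
  simp only [card_univ, sum_const, Fintype.card_fun, Fintype.card_fin, nsmul_eq_mul] at h
  have h2 : (2 : ℝ) ^ Fintype.card V ≠ 0 := by positivity
  push_cast at h
  exact mul_left_cancel₀ h2 h

theorem Provers.extractOn_univ_eq (v : V) (x : V → Fin 2) :
    P.extractOn univ x = P.extractOn (univ.erase v) x * P.extract v (x v) :=
  (noncommProd_erase_mul univ (mem_univ v) _ _ _).symm

theorem Provers.extractOn_univ_obs_Z (v : V) (x : V → Fin 2) (φ : H) :
    P.extractOn univ x (P.obs v .Z φ) = (-1 : ℂ) ^ (x v : ℕ) • P.extractOn univ x φ := by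
  have h := congrArg (fun M : H →L[ℂ] H => M φ) (P.extract_obs_Z v (x v))
  simp only [mul_apply_eq_comp, smul_apply] at h
  rw [P.extractOn_univ_eq v]
  simp [h]

theorem Provers.swap_obs_Z (v : V) (φ : H) :
    P.swap (P.obs v .Z φ) = registerOp v pauliZ (P.swap φ) := by
  ext x
  rw [registerOp_pauliZ_apply, P.swap_apply, P.swap_apply, P.extractOn_univ_obs_Z]

/-- The swap isometry takes `X_v` to the Pauli matrix as far as `X_v` and `Z_v` anticommute. -/
theorem Provers.norm_swap_obs_X_sub (v : V) (φ : H) :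
    2 * ‖P.swap (P.obs v .X φ) - registerOp v pauliX (P.swap φ)‖ ^ 2 = ‖P.anticomm v φ‖ ^ 2 := by
  set y : (V → Fin 2) → H := fun x =>
    P.extract v (x v) (P.obs v .X φ) - P.extract v (x v + 1) φ with hy
  have h := P.sum_norm_extractOn_sq (univ.erase v) y fun w hw x => by
    simp [hy, (ne_of_mem_erase hw).symm]
  have hxy : ∀ x, (P.swap (P.obs v .X φ) - registerOp v pauliX (P.swap φ)) x =
      P.extractOn (univ.erase v) x (y x) := by
    intro x
    rw [PiLp.sub_apply, registerOp_pauliX_apply, P.swap_apply, P.swap_apply,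
      P.extractOn_univ_eq v, P.extractOn_univ_eq v,
      P.extractOn_add_single (notMem_erase v univ)]
    simp [hy]
  rw [PiLp.norm_sq_eq_of_L2]
  simp only [hxy]
  simp only [hy, P.norm_extract_obs_X_sub, sum_const, card_univ, Fintype.card_fun,
    Fintype.card_fin, nsmul_eq_mul, card_erase_of_mem (mem_univ v)] at h
  have hpos : 0 < Fintype.card V := Fintype.card_pos_iff.2 ⟨v⟩
  obtain ⟨m, hm⟩ : ∃ m, Fintype.card V = m + 1 := Nat.exists_eq_add_of_lt hpos |>.imp (by simp)
  have h2 : (2 : ℝ) ^ m ≠ 0 := by positivity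
  rw [hm, Nat.add_sub_cancel, pow_succ 2 m] at h
  push_cast at h
  simp only [hy]
  refine mul_left_cancel₀ h2 ?_
  linarith

end swap

/-! ### The graph state -/

section graphState

variable {V : Type*} [Fintype V] [DecidableEq V] (G : SimpleGraph V) [DecidableRel G.Adj]

/-- The sign `(-1)^(e(x))` of the amplitude of `x` in the graph state. -/
def edgeSign (x : V → Fin 2) : ℂ :=
  (-1) ^ (G.edgeFinset.filter fun e => ∀ v ∈ e, x v = 1).card

/-- The eigenvalue of `Z^(A 1_v)` at the basis vector `x`. -/
def neighborSign (v : V) (x : V → Fin 2) : ℂ :=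
  ∏ w, if G.Adj v w then (-1) ^ (x w : ℕ) else 1

theorem edgeSign_mul_self (x : V → Fin 2) : edgeSign G x * edgeSign G x = 1 := by
  rw [edgeSign, ← mul_pow]; simp

theorem norm_edgeSign (x : V → Fin 2) : ‖edgeSign G x‖ = 1 := by simp [edgeSign]

omit [DecidableEq V] in
theorem norm_neighborSign (v : V) (x : V → Fin 2) : ‖neighborSign G v x‖ = 1 := by
  rw [neighborSign, norm_prod]
  exact prod_eq_one fun w _ => by split_ifs <;> simp

omit [DecidableEq V] in
theorem neighborSign_mul_self (v : V) (x : V → Fin 2) :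
    neighborSign G v x * neighborSign G v x = 1 := by
  rw [neighborSign, ← prod_mul_distrib]
  refine prod_eq_one fun w _ => ?_
  split_ifs
  · rw [← mul_pow]; simp
  · simp

theorem neighborSign_add_single (v : V) (x : V → Fin 2) :
    neighborSign G v (x + Pi.single v 1) = neighborSign G v x := by
  refine prod_congr rfl fun w _ => ?_
  by_cases h : w = v
  · subst h; simp
  · simp [h]

/-- Flipping the bit at `v` changes the number of edges inside the support of `x` by the number of
neighbours of `v` in it. -/
theorem edgeSign_add_single (v : V) (x : V → Fin 2) :
    edgeSign G (x + Pi.single v 1) = neighborSign G v x * edgeSign G x := by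
  have hprod : ∀ y : V → Fin 2,
      edgeSign G y = ∏ e ∈ G.edgeFinset, if ∀ w ∈ e, y w = 1 then (-1 : ℂ) else 1 := by
    intro y
    rw [edgeSign, prod_ite, prod_const, prod_const_one, mul_one]
  have hN : neighborSign G v x =
      ∏ e ∈ G.edgeFinset with v ∈ e,
        ((if ∀ w ∈ e, (x + Pi.single v 1 : V → Fin 2) w = 1 then (-1 : ℂ) else 1) *
        if ∀ w ∈ e, x w = 1 then (-1 : ℂ) else 1) := by
    -- The edges at `v` correspond to its neighbours `w`; the sign of `s(v, w)` changes
    -- iff `x w = 1`.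
    rw [neighborSign, ← prod_filter]
    refine prod_nbij (fun w => s(v, w)) ?_ ?_ ?_ ?_
    · intro w hw
      simpa using hw
    · intro w _ w' _ h
      rcases (by simpa using h : w = w' ∨ v = w' ∧ w = v) with h | ⟨h, h'⟩
      exacts [h, h'.trans h]
    · intro e he
      simp only [coe_filter, SimpleGraph.mem_edgeFinset, Set.mem_ofPred_eq] at he
      obtain ⟨w, rfl⟩ := Sym2.mem_iff_exists.1 he.2
      exact ⟨w, by simpa using he.1, rfl⟩
    · intro w hw
      have hvw : w ≠ v := by rintro rfl; simp at hw
      simp only [Sym2.mem_iff, forall_eq_or_imp, forall_eq, Pi.add_apply, Pi.single_eq_same,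
        Pi.single_eq_of_ne hvw, add_zero]
      generalize x v = a
      generalize x w = b
      fin_cases a <;> fin_cases b <;> simp
  rw [hN, hprod, hprod, prod_filter, ← prod_mul_distrib]
  refine prod_congr rfl fun e _ => ?_
  by_cases hv : v ∈ e
  · rw [if_pos hv, mul_assoc]
    split_ifs <;> simp
  · have : ∀ w ∈ e, (x + Pi.single v 1 : V → Fin 2) w = x w := by
      intro w hw
      have : w ≠ v := fun h => hv (h ▸ hw)
      simp [this]
    rw [if_neg hv, one_mul]
    exact if_congr (forall₂_congr fun w hw => by rw [this w hw]) rfl rfl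

theorem graphState_apply (x : V → Fin 2) :
    graphState G x = (1 / (Real.sqrt (2 ^ Fintype.card V) : ℂ)) * edgeSign G x := rfl

/-- A map that diagonalizes every `Z_w` diagonalizes `Z^(A 1_v)`. -/
theorem Provers.map_neighborZ {H E : Type*} [NormedAddCommGroup H] [InnerProductSpace ℂ H]
    [CompleteSpace H] [AddCommGroup E] [Module ℂ E] (P : Provers V H) {f : H → E} {σ : V → ℂ}
    (hf : ∀ w φ, f (P.obs w .Z φ) = σ w • f φ) (v : V) (φ : H) :
    f (P.neighborZ G v φ) = (∏ w, if G.Adj v w then σ w else 1) • f φ := by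
  have key : ∀ (s : Finset V) hc, f (s.noncommProd
      (fun w => P.evalWord w (if G.Adj v w then FreeMonoid.of .Z else 1)) hc φ) =
        (∏ w ∈ s, if G.Adj v w then σ w else 1) • f φ := by
    intro s
    induction s using Finset.induction_on with
    | empty =>
      intro hc
      rw [noncommProd_empty]
      simp
    | insert w s hw ih =>
      intro hc
      rw [noncommProd_insert_of_notMem _ _ _ _ hw, prod_insert hw, mul_smul,
        ← ih (hc.mono (coe_subset.2 (subset_insert w s)))]
      by_cases h : G.Adj v w <;> simp [h, hf]
  rw [Provers.neighborZ, P.wordOp_apply]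
  exact key univ _

end graphState

/-! ### The honest provers -/

section honest

variable {V : Type*} [Fintype V] [DecidableEq V] (G : SimpleGraph V) [DecidableRel G.Adj]
  (θ : V → ℝ)

theorem neg_one_pow_fin_add_one (a : Fin 2) :
    (-1 : ℂ) ^ ((a + 1 : Fin 2) : ℕ) = -(-1) ^ (a : ℕ) := by
  fin_cases a <;> simp

theorem honest_obs_X_apply (v : V) (φ : EuclideanSpace ℂ (V → Fin 2)) (x : V → Fin 2) :
    (honest G θ).obs v .X φ x = φ (x + Pi.single v 1) := localOp_pauliX_apply v φ x

theorem honest_obs_Z_apply (v : V) (φ : EuclideanSpace ℂ (V → Fin 2)) (x : V → Fin 2) :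
    (honest G θ).obs v .Z φ x = (-1 : ℂ) ^ (x v : ℕ) * φ x := localOp_pauliZ_apply v φ x

theorem honest_stabilizer (v : V) :
    (honest G θ).stabilizer G v (honest G θ).state = (honest G θ).state := by
  ext x
  rw [Provers.stabilizer_eq G, mul_apply_eq_comp, honest_obs_X_apply,
    (honest G θ).map_neighborZ G (f := fun φ => φ (x + Pi.single v 1))
      (fun w φ => honest_obs_Z_apply G θ w φ _)]
  change neighborSign G v (x + Pi.single v 1) * graphState G (x + Pi.single v 1) = graphState G x
  rw [neighborSign_add_single, graphState_apply, graphState_apply, edgeSign_add_single,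
    mul_left_comm, ← mul_assoc (neighborSign G v x), neighborSign_mul_self, one_mul]

theorem honest_anticomm (v : V) (φ : EuclideanSpace ℂ (V → Fin 2)) :
    (honest G θ).anticomm v φ = 0 := by
  ext x
  rw [Provers.anticomm_apply, PiLp.add_apply, honest_obs_X_apply, honest_obs_Z_apply,
    honest_obs_Z_apply, honest_obs_X_apply, Pi.add_apply, Pi.single_eq_same,
    neg_one_pow_fin_add_one]
  simp

theorem honest_rotationError (v : V) (t : ℤˣ) (φ : EuclideanSpace ℂ (V → Fin 2)) :
    (honest G θ).rotationError θ v t φ = 0 := by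
  have h : (honest G θ).obs v (.R t) φ = (Real.cos (θ v) : ℂ) • (honest G θ).obs v .X φ +
      (((t : ℤ) : ℂ) * (Real.sin (θ v) : ℂ)) • (honest G θ).obs v .Z φ := by
    ext x
    change localOp (D := fun _ => Fin 2) v (rotR (((t : ℤ) : ℝ) * θ v)) φ x = _ *
      localOp (D := fun _ => Fin 2) v pauliX φ x + _ * localOp (D := fun _ => Fin 2) v pauliZ φ x
    simp only [localOp_apply, rotR, Matrix.add_apply, Matrix.smul_apply, smul_eq_mul, add_mul,
      sum_add_distrib, mul_sum]
    rcases Int.units_eq_one_or t with rfl | rfl <;> simp <;> ring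
  simp only [Provers.rotationError, sub_apply, add_apply, smul_apply]
  rw [h, sub_self]

theorem honest_testAccept [Nonempty V] {T : Finset (Finset V)} (hT : ∀ τ ∈ T, G.IsNClique 3 τ)
    {u : V → V} (hu : ∀ v, G.Adj v (u v)) (hθ : ∀ v, 0 ≤ θ v ∧ θ v ≤ Real.pi / 2) :
    testAccept G T u θ (honest G θ) = cTest T θ := by
  have h := (honest G θ).cTest_sub_testAccept G T u hθ
  have hS : ∀ v, ‖(honest G θ).stabilizer G v (honest G θ).state - (honest G θ).state‖ = 0 :=
    fun v => by rw [honest_stabilizer, sub_self, norm_zero]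
  have hτ : ∀ τ ∈ T, ‖(honest G θ).queryOp (triangleQuery G τ) (honest G θ).state +
      (honest G θ).state‖ ^ 2 / 4 = 0 := by
    intro τ hτ
    have hne : τ.Nonempty := card_pos.1 (by rw [(hT τ hτ).card_eq]; norm_num)
    obtain ⟨v, hv⟩ := hne
    obtain ⟨a, c, hab, hac, hbc, rfl⟩ := exists_triangle_of_mem G (hT τ hτ) hv
    have := (honest G θ).abs_norm_anticomm_sub_le G hab hac hbc (honest G θ).state
    rw [honest_anticomm, hS, hS, hS, norm_zero, zero_sub, abs_neg, abs_norm] at this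
    rw [le_antisymm (this.trans_eq (by norm_num)) (norm_nonneg _)]
    norm_num
  have hR : ∀ v t, ‖(honest G θ).rthetaError G v (u v) (θ v) t‖ = 0 := by
    intro v t
    have := (honest G θ).norm_rthetaError_sub_le G θ (hu v) t
    rw [honest_rotationError, hS, hS, sub_zero] at this
    exact le_antisymm (this.trans_eq (by norm_num)) (norm_nonneg _)
  rw [sum_eq_zero hτ] at h
  simp only [hS, hR] at h
  have hN : (numSubtests V T : ℝ) ≠ 0 := by exact_mod_cast (numSubtests_pos V T).ne'
  have : cTest T θ - testAccept G T u θ (honest G θ) = 0 := by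
    simpa [hN] using h
  linarith

end honest

/-! ### Registers close to a graph state -/

section near

variable {V : Type*} [Fintype V] [DecidableEq V] (G : SimpleGraph V) [DecidableRel G.Adj]
  {H : Type*} [NormedAddCommGroup H]

theorem norm_register_congr {f g : Register V H} (h : ∀ x, ‖f x‖ = ‖g x‖) : ‖f‖ = ‖g‖ := by
  rw [← sq_eq_sq₀ (norm_nonneg _) (norm_nonneg _), PiLp.norm_sq_eq_of_L2, PiLp.norm_sq_eq_of_L2]
  simp only [h]

/-- The translation `x ↦ x + s` of the computational basis, as an operator on registers. -/
def translate (s : V → Fin 2) (f : Register V H) : Register V H :=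
  WithLp.toLp 2 fun x => f (x + s)

theorem norm_translate (s : V → Fin 2) (f : Register V H) : ‖translate s f‖ = ‖f‖ := by
  rw [← sq_eq_sq₀ (norm_nonneg _) (norm_nonneg _), PiLp.norm_sq_eq_of_L2, PiLp.norm_sq_eq_of_L2]
  exact sum_add_right_eq s fun x => ‖f x‖ ^ 2

/-- A translation is a composite of translations by unit vectors, and these are isometries, so that
the distances by which they move `f` add up. -/
theorem norm_sub_translate_le (s : V → Fin 2) (f : Register V H) :
    ‖f - translate s f‖ ≤ ∑ v, ‖f - translate (Pi.single v 1) f‖ := by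
  have h0 : ‖f - translate 0 f‖ = 0 := by simp [translate]
  have hadd : ∀ s t, ‖f - translate (s + t) f‖ ≤
      ‖f - translate s f‖ + ‖f - translate t f‖ := by
    intro s t
    have h : f - translate (s + t) f = (f - translate s f) + translate s (f - translate t f) := by
      ext x
      simp [translate, add_assoc]
    rw [h]
    exact (norm_add_le _ _).trans_eq (by rw [norm_translate])
  have h := le_sum_of_subadditive (fun s => ‖f - translate s f‖) h0.le hadd univ
    fun v => Pi.single v (s v)
  rw [univ_sum_single s] at h
  refine h.trans (sum_le_sum fun v _ => ?_)
  rcases (by decide : ∀ a : Fin 2, a = 0 ∨ a = 1) (s v) with hs | hs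
  · rw [hs, Pi.single_zero, h0]; exact norm_nonneg _
  · rw [hs]

variable [InnerProductSpace ℂ H]

/-- A register nearly invariant under the translations by unit vectors is close to a register with
constant coefficients: the mean over all translations. -/
theorem exists_const_near (f : Register V H) :
    ∃ m : H, ‖(WithLp.toLp 2 fun _ => m : Register V H)‖ ≤ ‖f‖ ∧
      ‖f - WithLp.toLp 2 fun _ => m‖ ≤ ∑ v, ‖f - translate (Pi.single v 1) f‖ := by
  have hN : (Fintype.card (V → Fin 2) : ℝ) ≠ 0 := by simp
  have hN' : (Fintype.card (V → Fin 2) : ℂ) ≠ 0 := by exact_mod_cast hN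
  have hmean : ∀ (F : (V → Fin 2) → Register V H) (C : ℝ), (∀ s, ‖F s‖ ≤ C) →
      ‖(Fintype.card (V → Fin 2) : ℂ)⁻¹ • ∑ s, F s‖ ≤ C := by
    intro F C hF
    rw [norm_smul, norm_inv, Complex.norm_natCast, inv_mul_le_iff₀ (by positivity)]
    exact (norm_sum_le_of_le _ fun s _ => hF s).trans_eq (by simp)
  have hm : (WithLp.toLp 2 fun _ => (Fintype.card (V → Fin 2) : ℂ)⁻¹ • ∑ s, f s : Register V H) =
      (Fintype.card (V → Fin 2) : ℂ)⁻¹ • ∑ s, translate s f := by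
    ext x
    simp only [PiLp.smul_apply, WithLp.ofLp_sum, Finset.sum_apply, translate]
    congr 1
    exact (Equiv.sum_comp (Equiv.addLeft x) fun s => f s).symm
  refine ⟨(Fintype.card (V → Fin 2) : ℂ)⁻¹ • ∑ s, f s, ?_, ?_⟩
  · rw [hm]
    exact hmean _ _ fun s => (norm_translate s f).le
  · have hf : f - (Fintype.card (V → Fin 2) : ℂ)⁻¹ • ∑ s, translate s f =
        (Fintype.card (V → Fin 2) : ℂ)⁻¹ • ∑ s, (f - translate s f) := by
      rw [sum_sub_distrib, smul_sub, sum_const, card_univ, ← Nat.cast_smul_eq_nsmul ℂ,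
        inv_smul_smul₀ hN']
    rw [hm, hf]
    exact hmean _ _ fun s => norm_sub_translate_le s f

/-- The stabilizer operator `X_v Z^(A 1_v)` on a register. -/
noncomputable def registerStabilizer (v : V) (f : Register V H) : Register V H :=
  WithLp.toLp 2 fun x => neighborSign G v x • f (x + Pi.single v 1)

/-- A register nearly fixed by the stabilizer operators is close to a graph state tensored with
some vector: the signs of the graph state turn the stabilizers into translations. -/
theorem exists_graphState_near (f : Register V H) :
    ∃ χ : H, ‖χ‖ ≤ ‖f‖ ∧
      ‖f - tensorVec (graphState G) χ‖ ≤ ∑ v, ‖f - registerStabilizer G v f‖ := by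
  obtain ⟨m, hm, hfm⟩ := exists_const_near
    (WithLp.toLp 2 fun x => edgeSign G x • f x : Register V H)
  have hsq : (Real.sqrt (2 ^ Fintype.card V) : ℂ) ≠ 0 := by
    have : (0 : ℝ) < Real.sqrt (2 ^ Fintype.card V) := by positivity
    exact_mod_cast this.ne'
  set χ : H := (Real.sqrt (2 ^ Fintype.card V) : ℂ) • m with hχ
  have ht : ∀ x, tensorVec (graphState G) χ x = edgeSign G x • m := by
    intro x
    change graphState G x • χ = _
    rw [graphState_apply, hχ, smul_smul]
    congr 1
    field_simp
  refine ⟨χ, ?_, ?_⟩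
  · have h1 : ‖χ‖ = ‖tensorVec (graphState G) χ‖ := by
      rw [norm_tensorVec, norm_graphState, one_mul]
    rw [h1]
    refine (norm_register_congr fun x => ?_).trans_le
      (hm.trans_eq (norm_register_congr fun x => ?_))
    · rw [ht, norm_smul, norm_edgeSign, one_mul]
    · simp [norm_smul, norm_edgeSign]
  · refine (norm_register_congr fun x => ?_).trans_le (hfm.trans_eq
      (sum_congr rfl fun v _ => norm_register_congr fun x => ?_))
    · have : f x - edgeSign G x • m = edgeSign G x • (edgeSign G x • f x - m) := by
        rw [smul_sub, smul_smul, edgeSign_mul_self, one_smul]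
      rw [PiLp.sub_apply, ht, this, norm_smul, norm_edgeSign, one_mul]
      rfl
    · have : edgeSign G x • f x - edgeSign G (x + Pi.single v 1) • f (x + Pi.single v 1) =
          edgeSign G x • (f x - neighborSign G v x • f (x + Pi.single v 1)) := by
        rw [edgeSign_add_single, smul_sub, smul_smul, mul_comm]
      change ‖edgeSign G x • f x - edgeSign G (x + Pi.single v 1) • f (x + Pi.single v 1)‖ = _
      rw [this, norm_smul, norm_edgeSign, one_mul]
      rfl

/-- On the swapped state the register's stabilizers inherit the relation tested in `VERTEX`, up to
the error with which `swap` intertwines `X`. -/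
theorem Provers.norm_swap_sub_registerStabilizer_le [CompleteSpace H] (P : Provers V H) (v : V)
    (φ : H) : ‖P.swap φ - registerStabilizer G v (P.swap φ)‖ ≤
      ‖P.stabilizer G v φ - φ‖ + ‖P.anticomm v φ‖ := by
  have hX : ‖P.swap (P.obs v .X φ) - registerOp v pauliX (P.swap φ)‖ ≤ ‖P.anticomm v φ‖ := by
    refine (sq_le_sq₀ (norm_nonneg _) (norm_nonneg _)).1 ?_
    have := P.norm_swap_obs_X_sub v φ
    nlinarith [sq_nonneg ‖P.swap (P.obs v .X φ) - registerOp v pauliX (P.swap φ)‖]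
  have hS : ‖P.swap (P.stabilizer G v φ) - registerStabilizer G v (P.swap φ)‖ =
      ‖P.swap (P.obs v .X φ) - registerOp v pauliX (P.swap φ)‖ := by
    refine norm_register_congr fun x => ?_
    rw [PiLp.sub_apply, PiLp.sub_apply, P.stabilizer_eq' G, mul_apply_eq_comp, P.swap_apply,
      P.map_neighborZ G (f := fun φ => P.extractOn univ x φ)
        (fun w φ => P.extractOn_univ_obs_Z w x φ), registerOp_pauliX_apply]
    change ‖neighborSign G v x • _ - neighborSign G v x • _‖ = _
    rw [← smul_sub, norm_smul, norm_neighborSign, one_mul]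
    rfl
  calc _ = ‖P.swap (φ - P.stabilizer G v φ) +
        (P.swap (P.stabilizer G v φ) - registerStabilizer G v (P.swap φ))‖ := by
        rw [map_sub, sub_add_sub_cancel]
    _ ≤ _ := (norm_add_le _ _).trans (by
        rw [P.norm_swap, norm_sub_rev, hS]
        gcongr)

end near

/-! ### Comparison with ideal measurements -/

section hybrid

variable {V : Type*} [Fintype V] [DecidableEq V]
  {H : Type*} [NormedAddCommGroup H] [InnerProductSpace ℂ H] [CompleteSpace H] (P : Provers V H)
  (θ : V → ℝ)

/-- A quadratic form in `φ` that bounds the squared errors that are made on `φ` when the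
observables of the prover `v` are replaced by the ideal ones. -/
noncomputable def Provers.localError (v : V) (φ : H) : ℝ :=
  ‖P.anticomm v φ‖ ^ 2 + 2 * ∑ t, ‖P.rotationError θ v t φ‖ ^ 2

omit [Fintype V] [DecidableEq V] in
theorem Provers.localError_nonneg (v : V) (φ : H) : 0 ≤ P.localError θ v φ := by
  unfold Provers.localError; positivity

/-- The observables of `v` are intertwined with the ideal ones up to `localError`; for `R(t θ)`, by
way of its expression through `X` and `Z`. -/
theorem Provers.norm_swap_obs_sub_sq_le (v : V) (b : Query) (φ : H) :
    ‖P.swap (P.obs v b φ) - registerOp v (idealObs (θ v) b) (P.swap φ)‖ ^ 2 ≤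
      P.localError θ v φ := by
  have hR : 0 ≤ ∑ t, ‖P.rotationError θ v t φ‖ ^ 2 := by positivity
  have hX := P.norm_swap_obs_X_sub v φ
  set D := P.swap (P.obs v .X φ) - registerOp v pauliX (P.swap φ) with hD
  unfold Provers.localError
  cases b with
  | X =>
    change ‖D‖ ^ 2 ≤ _
    nlinarith [sq_nonneg ‖D‖]
  | Z =>
    rw [show idealObs (θ v) .Z = pauliZ from rfl, P.swap_obs_Z, sub_self, norm_zero,
      zero_pow two_ne_zero]
    positivity
  | R t =>
    have hsplit : P.swap (P.obs v (.R t) φ) -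
        registerOp v (idealObs (θ v) (.R t)) (P.swap φ) =
        P.swap (P.rotationError θ v t φ) + (Real.cos (θ v) : ℂ) • D := by
      rw [registerOp_rotR]
      simp only [Provers.rotationError, sub_apply, add_apply, smul_apply, map_sub, map_add,
        map_smul, hD, P.swap_obs_Z]
      module
    have ht := single_le_sum (f := fun t => ‖P.rotationError θ v t φ‖ ^ 2)
      (fun t _ => by positivity) (mem_univ t)
    have hn : ‖P.swap (P.rotationError θ v t φ) + (Real.cos (θ v) : ℂ) • D‖ ≤
        ‖P.rotationError θ v t φ‖ + ‖D‖ := by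
      refine (norm_add_le _ _).trans ?_
      rw [P.norm_swap, norm_smul, Complex.norm_real]
      gcongr
      exact mul_le_of_le_one_left (norm_nonneg _) (Real.abs_cos_le_one _)
    rw [hsplit]
    have hsq := pow_le_pow_left₀ (norm_nonneg _) hn 2
    nlinarith [sq_nonneg (‖P.rotationError θ v t φ‖ - ‖D‖)]

omit [Fintype V] [DecidableEq V] in
/-- Questions to other provers leave the total error at a prover unchanged. -/
theorem Provers.sum_localError_proj {v w : V} (h : v ≠ w) (b : Query) (φ : H) :
    ∑ r, P.localError θ w (P.proj v b r φ) = P.localError θ w φ := by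
  have key : ∀ M : H →L[ℂ] H, Commute (P.obs v b) M →
      ∑ r, ‖M (P.proj v b r φ)‖ ^ 2 = ‖M φ‖ ^ 2 := by
    intro M hM
    rw [← P.sum_norm_proj_sq v b]
    refine sum_congr rfl fun r _ => ?_
    have := congrArg (fun N : H →L[ℂ] H => N φ) (P.commute_proj hM r).eq
    simp only [mul_apply_eq_comp] at this
    rw [this]
  have hc := fun c => P.commute_obs v w h b c
  have hA : Commute (P.obs v b) (P.anticomm w) :=
    ((hc _).mul_right (hc _)).add_right ((hc _).mul_right (hc _))
  have hE : ∀ t, Commute (P.obs v b) (P.rotationError θ w t) := fun t =>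
    (hc _).sub_right (((hc _).smul_right _).add_right ((hc _).smul_right _))
  simp only [Provers.localError, sum_add_distrib, ← mul_sum]
  rw [key _ hA, sum_comm]
  simp only [key _ (hE _)]

/-- Replacing the observables of all provers by the ideal ones. The errors made in one step of the
measurement are charged to the prover that is asked; those of later steps are not amplified, as the
projections of the steps before commute with them and add up to the identity over all branches. -/
theorem Provers.acceptFrom_le_ideal {f : Register V H} (hf : ‖f‖ = 1) {κ : ℝ} (hκ : 0 < κ)
    (A : AdaptiveMeasurement V) (S : Finset V) (hA : A.AsksOnce (S : Set V)) (φ : H) :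
    P.acceptFrom A φ ≤ (idealProvers θ f hf).acceptFrom A (P.swap φ) +
      ∑ w ∈ Sᶜ, (κ * ‖φ‖ ^ 2 + (1 + 1 / κ) * P.localError θ w φ) := by
  induction A generalizing S φ with
  | halt a =>
    have h : 0 ≤ ∑ w ∈ Sᶜ, (κ * ‖φ‖ ^ 2 + (1 + 1 / κ) * P.localError θ w φ) :=
      sum_nonneg fun w _ => by have := P.localError_nonneg θ w φ; positivity
    cases a <;> simpa [Provers.acceptFrom, P.norm_swap] using h
  | ask v b next ih =>
    obtain ⟨hv, hnext⟩ := hA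
    have hvS : v ∉ S := by simpa using hv
    set Q := idealProvers θ f hf with hQ
    have hstep : ∀ r, P.acceptFrom (next r) (P.proj v b r φ) ≤
        Q.acceptFrom (next r) (Q.proj v b r (P.swap φ)) + κ * ‖Q.proj v b r (P.swap φ)‖ ^ 2 +
        (1 + 1 / κ) * (P.localError θ v φ / 4) +
        ∑ w ∈ (insert v S)ᶜ, (κ * ‖P.proj v b r φ‖ ^ 2 +
          (1 + 1 / κ) * P.localError θ w (P.proj v b r φ)) := by
      intro r
      have h1 := ih r (insert v S) (by simpa using hnext r) (P.proj v b r φ)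
      have h2 := Q.acceptFrom_le_add (next r) (P.swap (P.proj v b r φ))
        (Q.proj v b r (P.swap φ)) hκ
      have h3 : ‖P.swap (P.proj v b r φ) - Q.proj v b r (P.swap φ)‖ ^ 2 ≤
          P.localError θ v φ / 4 := by
        have heq : P.swap (P.proj v b r φ) - Q.proj v b r (P.swap φ) =
            ((1 / 2 : ℂ) * ((r : ℤ) : ℂ)) •
              (P.swap (P.obs v b φ) - registerOp v (idealObs (θ v) b) (P.swap φ)) := by
          rw [P.proj_apply, Q.proj_apply, map_smul, map_add, map_smul]
          change _ - (1 / 2 : ℂ) • (_ + _ • registerOp v (idealObs (θ v) b) (P.swap φ)) = _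
          module
        have hr : ‖((r : ℤ) : ℂ)‖ = 1 := by
          rcases Int.units_eq_one_or r with rfl | rfl <;> simp
        have := P.norm_swap_obs_sub_sq_le θ v b φ
        rw [heq, norm_smul, norm_mul, hr, mul_pow]
        norm_num
        linarith
      have h4 : (1 + 1 / κ) * ‖P.swap (P.proj v b r φ) - Q.proj v b r (P.swap φ)‖ ^ 2 ≤
          (1 + 1 / κ) * (P.localError θ v φ / 4) := by gcongr
      linarith
    have hsum := sum_le_sum fun r (_ : r ∈ univ) => hstep r
    have hins : Sᶜ = insert v (insert v S)ᶜ := by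
      ext w
      by_cases h : w = v
      · subst h; simpa using hvS
      · simp [h]
    have hrest : ∑ r, ∑ w ∈ (insert v S)ᶜ, (κ * ‖P.proj v b r φ‖ ^ 2 +
        (1 + 1 / κ) * P.localError θ w (P.proj v b r φ)) =
        ∑ w ∈ (insert v S)ᶜ, (κ * ‖φ‖ ^ 2 + (1 + 1 / κ) * P.localError θ w φ) := by
      rw [sum_comm]
      refine sum_congr rfl fun w hw => ?_
      have hvw : v ≠ w := by rintro rfl; simp at hw
      rw [sum_add_distrib, ← mul_sum, ← mul_sum, P.sum_norm_proj_sq,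
        P.sum_localError_proj θ hvw]
    rw [sum_add_distrib, sum_add_distrib, sum_add_distrib, hrest, ← mul_sum, Q.sum_norm_proj_sq,
      P.norm_swap, sum_intUnits fun _ => (1 + 1 / κ) * (P.localError θ v φ / 4)] at hsum
    rw [P.acceptFrom_ask, Q.acceptFrom_ask, hins, sum_insert (by simp)]
    have hE := P.localError_nonneg θ v φ
    have : (1 + 1 / κ) * (P.localError θ v φ / 4) + (1 + 1 / κ) * (P.localError θ v φ / 4) ≤
        (1 + 1 / κ) * P.localError θ v φ := by
      have : 0 ≤ (1 + 1 / κ) * P.localError θ v φ := by positivity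
      linarith
    linarith

end hybrid

section soundness

variable {V : Type*} [Fintype V] [DecidableEq V] (G : SimpleGraph V) [DecidableRel G.Adj]
  {H : Type*} [NormedAddCommGroup H] [InnerProductSpace ℂ H] [CompleteSpace H] (P : Provers V H)

/-- Provers that pass the test for honesty with probability close to `c_test` give nearly the same
answer as the honest provers in every adaptive measurement. -/
theorem Provers.accept_le_honest_add [Nonempty V] {T : Finset (Finset V)}
    (hT : ∀ τ ∈ T, G.IsNClique 3 τ) (hcover : ∀ v, ∃ τ ∈ T, v ∈ τ) {u : V → V}
    (hu : ∀ v, G.Adj v (u v)) {θ : V → ℝ} (hθ : ∀ v, 0 ≤ θ v ∧ θ v ≤ Real.pi / 2)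
    {A : AdaptiveMeasurement V} (hA : A.AsksOnce ∅) {δ η : ℝ} (hδ : 0 < δ) (hδ1 : δ ≤ 1)
    (hη : 0 ≤ η) (h : numSubtests V T * (cTest T θ - testAccept G T u θ P) ≤ η ^ 2)
    (hηδ : 5760 * (Fintype.card V : ℝ) ^ 3 * η ^ 2 ≤ δ ^ 2) :
    P.accept A ≤ (honest G θ).accept A + δ := by
  obtain ⟨hS, hτ, hR⟩ := P.errors_le G hθ hη h
  have hanti : ∀ v, ‖P.anticomm v P.state‖ ≤ 8 * η := by
    intro v
    obtain ⟨τ, hτT, hv⟩ := hcover v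
    obtain ⟨a, c, hab, hac, hbc, rfl⟩ := exists_triangle_of_mem G (hT τ hτT) hv
    have h1 := (abs_le.1 (P.abs_norm_anticomm_sub_le G hab hac hbc P.state)).2
    linarith [hS a, hS v, hS c, hτ _ hτT]
  have hrot : ∀ v t, ‖P.rotationError θ v t P.state‖ ≤ 7 * η := by
    intro v t
    have h1 := P.norm_rthetaError_sub_le G θ (hu v) t
    have h2 := norm_sub_norm_le (P.rotationError θ v t P.state)
      (P.rthetaError G v (u v) (θ v) t)
    rw [norm_sub_rev] at h2
    linarith [hS v, hS (u v), hR v t]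
  have hlocal : ∀ v, P.localError θ v P.state ≤ 260 * η ^ 2 := by
    intro v
    have h1 := pow_le_pow_left₀ (norm_nonneg _) (hanti v) 2
    have h2 := pow_le_pow_left₀ (norm_nonneg _) (hrot v 1) 2
    have h3 := pow_le_pow_left₀ (norm_nonneg _) (hrot v (-1)) 2
    rw [Provers.localError, sum_intUnits]
    linarith
  have hswap : ‖P.swap P.state‖ = 1 := by rw [P.norm_swap, P.norm_state]
  set n : ℝ := (Fintype.card V : ℝ) with hn
  have hn1 : 1 ≤ n := by
    rw [hn]; exact_mod_cast Fintype.card_pos (α := V)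
  obtain ⟨χ, hχ, hfχ⟩ := exists_graphState_near G (P.swap P.state)
  have hdist : ‖P.swap P.state - tensorVec (graphState G) χ‖ ≤ n * (10 * η) := by
    refine hfχ.trans ((sum_le_card_nsmul _ _ (10 * η) fun v _ => ?_).trans_eq (by simp [hn]))
    linarith [P.norm_swap_sub_registerStabilizer_le G v P.state, hS v, hanti v]
  rw [hswap] at hχ
  -- The errors are split evenly between the terms with `κ` and those with `1 / κ`.
  set κ : ℝ := δ / (4 * n) with hκ
  have hκ0 : 0 < κ := by positivity
  have hκ1 : 1 + 1 / κ ≤ 8 * n / δ := by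
    have : κ ≤ 1 := by rw [hκ, div_le_one (by positivity)]; linarith
    have h1 : 1 ≤ 1 / κ := by rw [le_div_iff₀ hκ0]; linarith
    have h2 : 8 * n / δ = 2 * (1 / κ) := by rw [hκ]; field_simp; norm_num
    linarith
  have hstep1 := P.acceptFrom_le_ideal θ hswap hκ0 A ∅ (by simpa using hA) P.state
  have hstep2 := (idealProvers θ (P.swap P.state) hswap).acceptFrom_le_add A (P.swap P.state)
    (tensorVec (graphState G) χ) hκ0
  rw [idealProvers_acceptFrom_tensorVec G θ] at hstep2
  have hstate : (honest G θ).acceptFrom A (graphState G) * ‖χ‖ ^ 2 ≤ (honest G θ).accept A :=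
    mul_le_of_le_one_right (Provers.acceptFrom_nonneg _ _ _) (pow_le_one₀ (norm_nonneg _) hχ)
  have hnorm : ‖tensorVec (graphState G) χ‖ ^ 2 ≤ 1 := by
    rw [norm_tensorVec, norm_graphState, one_mul]
    exact pow_le_one₀ (norm_nonneg _) hχ
  have hcharge : ∑ w ∈ (∅ : Finset V)ᶜ, (κ * ‖P.state‖ ^ 2 +
      (1 + 1 / κ) * P.localError θ w P.state) ≤ n * (κ + (1 + 1 / κ) * (260 * η ^ 2)) := by
    refine (sum_le_card_nsmul _ _ (κ + (1 + 1 / κ) * (260 * η ^ 2)) fun w _ => ?_).trans_eq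
      (by rw [compl_empty, card_univ, nsmul_eq_mul])
    have := mul_le_mul_of_nonneg_left (hlocal w) (by positivity : 0 ≤ 1 + 1 / κ)
    rw [P.norm_state]
    linarith
  have hd2 : ‖P.swap P.state - tensorVec (graphState G) χ‖ ^ 2 ≤ (n * (10 * η)) ^ 2 :=
    pow_le_pow_left₀ (norm_nonneg _) hdist 2
  have hd3 := mul_le_mul_of_nonneg_left hd2 (by positivity : 0 ≤ 1 + 1 / κ)
  have hd4 := mul_le_mul_of_nonneg_left hnorm hκ0.le
  have hk : (n + 1) * κ ≤ δ / 2 := by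
    have : 2 * n * κ = δ / 2 := by rw [hκ]; field_simp; norm_num
    nlinarith
  have hη2 : n * (260 * η ^ 2) + (n * (10 * η)) ^ 2 ≤ 360 * n ^ 2 * η ^ 2 := by
    have : n * η ^ 2 ≤ n ^ 2 * η ^ 2 := by
      have : n ≤ n ^ 2 := by nlinarith
      gcongr
    nlinarith
  have hlast : (1 + 1 / κ) * (n * (260 * η ^ 2) + (n * (10 * η)) ^ 2) ≤ δ / 2 := by
    calc _ ≤ 8 * n / δ * (360 * n ^ 2 * η ^ 2) := by gcongr
      _ = 5760 * n ^ 3 * η ^ 2 / (2 * δ) := by ring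
      _ ≤ δ ^ 2 / (2 * δ) := by gcongr
      _ = δ / 2 := by field_simp
  have hPA : P.accept A = P.acceptFrom A P.state := rfl
  rw [hPA]
  linarith

end soundness

/-! ### The probability of choosing the calculation -/

/-- A bound that holds for every graph. In the lattice the number of triangles is linear in `|V|`,
but the distance between `c_test` and `s_test` leaves room for the cruder bound. -/
theorem numSubtests_le {V : Type*} [Fintype V] {T : Finset (Finset V)} (hT : ∀ τ ∈ T, τ.card = 3) :
    (numSubtests V T : ℝ) ≤ 4 * (Fintype.card V : ℝ) ^ 3 := by
  have h1 : T.card ≤ Fintype.card V ^ 3 := by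
    refine (card_le_card (t := powersetCard 3 univ) fun τ hτ => ?_).trans ?_
    · exact mem_powersetCard.2 ⟨subset_univ _, hT τ hτ⟩
    · rw [card_powersetCard, card_univ]
      exact Nat.choose_le_pow _ _
  have h2 : Fintype.card V ≤ Fintype.card V ^ 3 := Nat.le_self_pow (by norm_num) _
  have h3 : numSubtests V T ≤ 4 * Fintype.card V ^ 3 := by unfold numSubtests; omega
  exact_mod_cast h3

/-- The completeness and soundness gap of the protocol. With `Δ = c_test - s_test`, the choice of
`q` makes both terms of `s_ip` lie below `c_ip` by the same amount. -/
theorem cIP_sub_sIP {cT sT cC sC δ : ℝ} (hD : 1 + cT - sC - sT - δ ≠ 0) :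
    cIP (qCalculate cT sT sC δ) cT cC - sIP (qCalculate cT sT sC δ) cT sT sC δ =
      (cT - sT) * (cC - sC - δ) / (1 + cT - sC - sT - δ) := by
  have h : qCalculate cT sT sC δ * (sC + δ) + (1 - qCalculate cT sT sC δ) * cT =
      qCalculate cT sT sC δ + (1 - qCalculate cT sT sC δ) * sT := by
    unfold qCalculate
    field_simp
    ring
  rw [sIP, h, max_self, cIP, qCalculate]
  field_simp
  ring

end MBQC

theorem mainTheorem8 {α : Type*} (L : Language α) (x : List α)
    {V : Type*} [Fintype V] [DecidableEq V]
    (G : SimpleGraph V) [DecidableRel G.Adj] (hG : MBQC.IsTriangularLattice G)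
    (T : Finset (Finset V)) (hT : ∀ τ ∈ T, G.IsNClique 3 τ) (hcover : ∀ v, ∃ τ ∈ T, v ∈ τ)
    (u : V → V) (hu : ∀ v, G.Adj v (u v))
    (θ : V → ℝ) (hθ : ∀ v, 0 ≤ θ v ∧ θ v ≤ Real.pi / 2)
    (A : MBQC.AdaptiveMeasurement V) (hA : A.AsksOnce ∅)
    (cCalc sCalc : ℝ) (hcCalc : 2 / 3 ≤ cCalc) (hsCalc : sCalc ≤ 1 / 3)
    (hmem : x ∈ L → cCalc ≤ (MBQC.honest G θ).accept A)
    (hnot : x ∉ L → (MBQC.honest G θ).accept A ≤ sCalc)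
    (δ : ℝ) (hδ : 0 < δ) (hδ' : δ < 1 / 6)
    (cTest sTest q cIP sIP : ℝ)
    (hcTest : cTest = MBQC.cTest T θ) (hsTest : sTest = MBQC.sTest T θ δ)
    (hq : q = MBQC.qCalculate cTest sTest sCalc δ)
    (hcIP : cIP = MBQC.cIP q cTest cCalc)
    (hsIP : sIP = MBQC.sIP q cTest sTest sCalc δ) :
    (0 ≤ q ∧ q ≤ 1) ∧
    (x ∈ L → cIP ≤ MBQC.ipAccept G T u θ A q (MBQC.honest G θ)) ∧
    (x ∉ L → ∀ (H : Type*) [NormedAddCommGroup H] [InnerProductSpace ℂ H] [CompleteSpace H]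
      (P : MBQC.Provers V H), MBQC.ipAccept G T u θ A q P ≤ sIP) ∧
    δ ^ 8 / ((10 : ℝ) ^ (18.8 : ℝ) * (Fintype.card V : ℝ) ^ 11) ≤ cIP - sIP := by
  have hV : Nonempty V := hG.1
  set n : ℝ := (Fintype.card V : ℝ) with hn
  have hn1 : 1 ≤ n := by
    rw [hn]; exact_mod_cast Fintype.card_pos (α := V)
  have hten : (0 : ℝ) < (10 : ℝ) ^ (17.7 : ℝ) := by positivity
  set Δ : ℝ := δ ^ 8 / ((10 : ℝ) ^ (17.7 : ℝ) * n ^ 11) with hΔ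
  have hΔ0 : 0 < Δ := by positivity
  have hgap : cTest - sTest = Δ := by rw [hsTest, hcTest, MBQC.sTest]; ring
  have hden : 1 + cTest - sCalc - sTest - δ = 1 - sCalc - δ + Δ := by linarith
  have hden0 : 0 < 1 - sCalc - δ + Δ := by linarith
  have hqeq : q = Δ / (1 - sCalc - δ + Δ) := by rw [hq, MBQC.qCalculate, hgap, hden]
  have hq0 : 0 ≤ q := by rw [hqeq]; positivity
  have hq1 : q ≤ 1 := by rw [hqeq, div_le_one hden0]; linarith
  -- The exponent `17.7` leaves so much room that `17` is enough in the bounds on errors.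
  have hΔ17 : Δ ≤ δ ^ 8 / ((10 : ℝ) ^ 17 * n ^ 11) := by
    have h17 : (10 : ℝ) ^ 17 ≤ (10 : ℝ) ^ (17.7 : ℝ) := by
      rw [← Real.rpow_natCast]
      exact Real.rpow_le_rpow_of_exponent_le (by norm_num) (by norm_num)
    rw [hΔ]
    gcongr
  refine ⟨⟨hq0, hq1⟩, fun hx => ?_, fun hx H _ _ _ P => ?_, ?_⟩
  · rw [hcIP, MBQC.cIP, MBQC.ipAccept, MBQC.honest_testAccept G θ hT hu hθ, ← hcTest]
    gcongr
    exact hmem hx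
  · rw [hsIP, MBQC.sIP, MBQC.ipAccept]
    have hle := P.testAccept_le_cTest G T u hθ
    -- Provers with too small a chance in the test may pass `CALCULATE` for sure; the others are
    -- close to the honest provers.
    by_cases hpass : MBQC.testAccept G T u θ P ≤ sTest
    · refine le_max_of_le_right (add_le_add (mul_le_of_le_one_right hq0 (P.accept_le_one A)) ?_)
      exact mul_le_mul_of_nonneg_left hpass (by linarith)
    · refine le_max_of_le_left (add_le_add ?_ ?_)
      · have hN := MBQC.numSubtests_le fun τ hτ => (hT τ hτ).card_eq
        have hε : MBQC.numSubtests V T * (MBQC.cTest T θ - MBQC.testAccept G T u θ P) ≤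
            Real.sqrt (4 * n ^ 3 * Δ) ^ 2 := by
          rw [Real.sq_sqrt (by positivity)]
          have : MBQC.cTest T θ - MBQC.testAccept G T u θ P ≤ Δ := by linarith
          have h0 : 0 ≤ MBQC.cTest T θ - MBQC.testAccept G T u θ P := by linarith
          gcongr
        have hbound : 5760 * n ^ 3 * Real.sqrt (4 * n ^ 3 * Δ) ^ 2 ≤ δ ^ 2 := by
          rw [Real.sq_sqrt (by positivity)]
          have hδ6 : δ ^ 6 ≤ 1 := pow_le_one₀ hδ.le (by linarith)
          have hn6 : n ^ 6 ≤ n ^ 11 := pow_le_pow_right₀ hn1 (by norm_num)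
          calc 5760 * n ^ 3 * (4 * n ^ 3 * Δ)
              ≤ 5760 * n ^ 3 * (4 * n ^ 3 * (δ ^ 8 / ((10 : ℝ) ^ 17 * n ^ 11))) := by gcongr
            _ = δ ^ 2 * (δ ^ 6 * (n ^ 6 / n ^ 11) * (23040 / 10 ^ 17)) := by field_simp; norm_num
            _ ≤ δ ^ 2 * (1 * 1 * 1) := by
              gcongr
              · exact div_le_one_of_le₀ hn6 (by positivity)
              · norm_num
            _ = δ ^ 2 := by ring
        have h := P.accept_le_honest_add G hT hcover hu hθ hA hδ (by linarith)
          (Real.sqrt_nonneg _) hε hbound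
        exact mul_le_mul_of_nonneg_left (by linarith [hnot hx]) hq0
      · rw [hcTest]
        exact mul_le_mul_of_nonneg_left hle (by linarith)
  · rw [hcIP, hsIP, hq, MBQC.cIP_sub_sIP (by rw [hden]; exact hden0.ne'), hgap, hden]
    have h188 : (10 : ℝ) ^ (17.7 : ℝ) * 10 ≤ (10 : ℝ) ^ (18.8 : ℝ) := by
      rw [← Real.rpow_add_one (by norm_num)]
      exact Real.rpow_le_rpow_of_exponent_le (by norm_num) (by norm_num)
    have hΔ1 : Δ ≤ 1 := by
      refine hΔ17.trans (div_le_one_of_le₀ ?_ (by positivity))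
      have h1 : δ ^ 8 ≤ 1 := pow_le_one₀ hδ.le (by linarith)
      have h2 : 1 ≤ n ^ 11 := one_le_pow₀ hn1
      nlinarith
    calc δ ^ 8 / ((10 : ℝ) ^ (18.8 : ℝ) * n ^ 11)
        ≤ δ ^ 8 / ((10 : ℝ) ^ (17.7 : ℝ) * 10 * n ^ 11) := by gcongr
      _ = Δ * (1 / 10) := by rw [hΔ]; field_simp
      _ ≤ Δ * ((cCalc - sCalc - δ) / (1 - sCalc - δ + Δ)) := by
        refine mul_le_mul_of_nonneg_left ?_ hΔ0.le
        rw [div_le_div_iff₀ (by norm_num) hden0]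
        linarith
      _ = _ := by ring
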